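/- Let $0<q<1$, let $d\ge 1$ be an integer and let $\alpha_1,\dots,\alpha_d>0$. For $\alpha>0$ let $V^{(\alpha)}$ be the vector space (over $\mathbb R$ or $\mathbb C$) with orthonormal basis $e^{(\alpha)}_n$, $n=0,1,2,\dots$, on which $su_q(1,1)$ acts by $$A_0e_n^{(\alpha)}=\Bigl(n+\tfrac{\alpha+1}2\Bigr)e_n^{(\alpha)},\qquad A_+e_n^{(\alpha)}=\sqrt{\sigma^{(\alpha)}_{n+1}}\,e_{n+1}^{(\alpha)},\qquad A_-e_n^{(\alpha)}=\sqrt{\sigma^{(\alpha)}_n}\,e_{n-1}^{(\alpha)},\qquad \sigma_n^{(\alpha)}=q^{1/2}\frac{(1-q^n)(1-q^{n+\alpha})}{(1-q)^2}.$$ Let $W=V^{(\alpha_1)}\otimes\cdots\otimes V^{(\alpha_d)}$, with orthonormal basis $e_{\boldsymbol y}=e_{y_1}^{(\alpha_1)}\otimes\cdots\otimes e_{y_d}^{(\alpha_d)}$, $\boldsymbol y\in\mathbb Z_{\ge0}^d$. Let $A_0^{(k)},A_\pm^{(k)}$ be the generators acting on the $k$-th factor, and for $1\le k\le d$ put $$A_0^{[1;k]}=\sum_{i=1}^kA_0^{(i)},\qquad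 A_\pm^{[1;k]}=\sum_{i=1}^kq^{A_0^{(1)}+\cdots+A_0^{(i-1)}}A_\pm^{(i)},$$ $$\Gamma^{[1;k]}=\frac{q^{-1/2}q^{A_0^{[1;k]}}+q^{1/2}q^{-A_0^{[1;k]}}}{(q^{1/2}-q^{-1/2})^2}-A_+^{[1;k]}A_-^{[1;k]}q^{1-A_0^{[1;k]}}.$$ Let $\gamma(a)=\dfrac{q^{a/2}+q^{-a/2}}{(q^{1/2}-q^{-1/2})^2}$, $N_k=\sum_{i\le k}n_i$, $Y_k=\sum_{i\le k}y_i$ and $A_k=\sum_{i\le k}\alpha_i$. A coupled basis is an orthonormal basis $(g_{\boldsymbol n})_{\boldsymbol n\in\mathbb Z_{\ge0}^d}$ of $W$ such that $$\Gamma^{[1;k]}g_{\boldsymbol n}=\gamma(2N_{k-1}+A_k+k-1)\,g_{\boldsymbol n}\quad(2\le k\le d),\qquad q^{A_0^{[1;d]}}g_{\boldsymbol n}=q^{N_d+(A_d+d)/2}g_{\boldsymbol n}.$$ With $(a;q)_n=\prod_{i=0}^{n-1}(1-aq^i)$ and ${}_3\phi_2$ the basic hypergeometric series, set, for integers $0\le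 n,x\le N$, $$h_n(x,\alpha,\beta,N;q)=(q^{\alpha+1};q)_n(q^{-N};q)_n\;{}_3\phi_2\left(\begin{matrix}q^{-n},\,q^{n+\alpha+\beta+1},\,q^{-x}\\ q^{\alpha+1},\,q^{-N}\end{matrix};q,q\right),$$ $$\omega(x;\alpha,\beta,N;q)=\frac{(q^{\alpha+1};q)_x(q^{\beta+1};q)_{N-x}}{(q;q)_x(q;q)_{N-x}}\,q^{(N-x)(\alpha+1)},$$ $$\eta(n,\alpha,\beta,N;q)=\frac{(q^{\alpha+\beta+2};q)_{n+N}}{(q;q)_{N-n}}\,q^{2\binom n2-2Nn}\,\frac{1-q^{\alpha+\beta+1}}{1-q^{2n+\alpha+\beta+1}}\,\frac{(q;q)_n(q^{\alpha+1};q)_n(q^{\beta+1};q)_n}{(q^{\alpha+\beta+1};q)_n}\,q^{n(\alpha+1)},$$ $$\widehat h_n(x,\alpha,\beta,N;q)=\sqrt{\frac{\omega(x;\alpha,\beta,N;q)}{\eta(n,\alpha,\beta,N;q)}}\;h_n(x,\alpha,\beta,N;q),$$ and $\widehat h_n(x,\alpha,\beta,N;q)=0$ if not both $0\le x\le N$ and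 $0\le n\le N$. Define $$\Psi_{\boldsymbol n}(\boldsymbol y)=\delta_{N_dY_d}\prod_{k=1}^{d-1}\widehat h_{n_k}\bigl(Y_k-N_{k-1},\;2N_{k-1}+A_k+k-1,\;\alpha_{k+1},\;Y_{k+1}-N_{k-1};\,q\bigr).$$ Then for each $\boldsymbol n$ only finitely many $\Psi_{\boldsymbol n}(\boldsymbol y)$ are nonzero, for each $\boldsymbol y$ only finitely many $\Psi_{\boldsymbol n}(\boldsymbol y)$ are nonzero, and $$\sum_{\boldsymbol y}\Psi_{\boldsymbol n}(\boldsymbol y)\Psi_{\boldsymbol n'}(\boldsymbol y)=\delta_{\boldsymbol n\boldsymbol n'},\qquad\sum_{\boldsymbol n}\Psi_{\boldsymbol n}(\boldsymbol y)\Psi_{\boldsymbol n}(\boldsymbol y')=\delta_{\boldsymbol y\boldsymbol y'}.$$ Moreover, there is a coupled basis $(g_{\boldsymbol n})$ with $$g_{\boldsymbol n}=\sum_{\boldsymbol y}\Psi_{\boldsymbol n}(\boldsymbol y)\,e_{\boldsymbol y},\qquad e_{\boldsymbol y}=\sum_{\boldsymbol n}\Psi_{\boldsymbol n}(\boldsymbol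 y)\,g_{\boldsymbol n}\qquad(*)$$ for all $\boldsymbol n,\boldsymbol y$, and every coupled basis satisfies $(*)$ after each vector $g_{\boldsymbol n}$ is multiplied by a suitable scalar of absolute value $1$. -/

import Mathlib

open scoped TensorProduct ComplexConjugate

noncomputable section

namespace SuQ

/-! ### Basic hypergeometric series and `q`-Hahn functions -/

/-- The `q`-Pochhammer symbol `(a;q)_n`. -/
def qPoch (a q : ℝ) (n : ℕ) : ℝ := ∏ i ∈ Finset.range n, (1 - a * q ^ i)

/-- The basic hypergeometric series `_rφ_s` with upper parameters `a`, lower parameters `b`,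
base `q` and argument `z`. -/
def basicHypergeometric (a b : List ℝ) (q z : ℝ) : ℝ :=
  ∑' k : ℕ,
    (a.map fun c => qPoch c q k).prod / (qPoch q q k * (b.map fun c => qPoch c q k).prod)
      * ((-1) ^ k * q ^ k.choose 2) ^ ((1 : ℤ) + (b.length : ℤ) - (a.length : ℤ)) * z ^ k

/-- The `q`-Hahn polynomial `h_n(x, α, β, N; q)`, for `n, x ≤ N`. The series terminates after
the term of index `min n x ≤ N`; the later terms, which have a factor `0` in the numerator, vanish
(also those of index `> N`, by `0 / 0 = 0`). -/
def hahn (q : ℝ) (n x : ℕ) (α β : ℝ) (N : ℕ) : ℝ :=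
  qPoch (q ^ (α + 1)) q n * qPoch (q ^ (-(N : ℝ))) q n *
    basicHypergeometric [q ^ (-(n : ℝ)), q ^ (n + α + β + 1), q ^ (-(x : ℝ))]
      [q ^ (α + 1), q ^ (-(N : ℝ))] q q

/-- The weight `ω(x; α, β, N; q)`, for `x ≤ N`. -/
def hahnWeight (q : ℝ) (x : ℕ) (α β : ℝ) (N : ℕ) : ℝ :=
  qPoch (q ^ (α + 1)) q x * qPoch (q ^ (β + 1)) q (N - x) / (qPoch q q x * qPoch q q (N - x))
    * q ^ (((N : ℝ) - x) * (α + 1))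

/-- The normalization `η(n, α, β, N; q)`, for `n ≤ N`. -/
def hahnNorm (q : ℝ) (n : ℕ) (α β : ℝ) (N : ℕ) : ℝ :=
  qPoch (q ^ (α + β + 2)) q (n + N) / qPoch q q (N - n)
    * q ^ (2 * (n.choose 2 : ℝ) - 2 * (N : ℝ) * n)
    * ((1 - q ^ (α + β + 1)) / (1 - q ^ (2 * (n : ℝ) + α + β + 1)))
    * (qPoch q q n * qPoch (q ^ (α + 1)) q n * qPoch (q ^ (β + 1)) q n
        / qPoch (q ^ (α + β + 1)) q n)
    * q ^ ((n : ℝ) * (α + 1))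

/-- The orthonormal `q`-Hahn function `ĥ_n(x, α, β, N; q)`. It lives on `0 ≤ x ≤ N` and
`0 ≤ n ≤ N`, and is `0` outside that range, as a Clebsch–Gordan coefficient is. -/
def hahnFun (q : ℝ) (n : ℕ) (x : ℤ) (α β : ℝ) (N : ℤ) : ℝ :=
  if 0 ≤ x ∧ x ≤ N ∧ (n : ℤ) ≤ N then
    √(hahnWeight q x.toNat α β N.toNat / hahnNorm q n α β N.toNat)
      * hahn q n x.toNat α β N.toNat
  else 0

/-- The partial sum `v_1 + ⋯ + v_k` of a tuple `(v_1, …, v_d)`. -/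
def psum {d : ℕ} {M : Type*} [AddCommMonoid M] (v : Fin d → M) (k : ℕ) : M :=
  ∑ i with i.val < k, v i

/-- The functions `Ψ_n(y)`. The factor with (zero-based) index `j` is the factor `k = j + 1` of
the product over `1 ≤ k ≤ d - 1`. -/
def Psi {d : ℕ} (q : ℝ) (α : Fin d → ℝ) (n y : Fin d → ℕ) : ℝ :=
  (if psum n d = psum y d then 1 else 0) *
    ∏ j : Fin (d - 1),
      hahnFun q (n ⟨j, by omega⟩)
        (((psum y (j + 1) : ℕ) : ℤ) - ((psum n j : ℕ) : ℤ))
        (2 * ((psum n j : ℕ) : ℝ) + psum α (j + 1) + j)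
        (α ⟨j + 1, by omega⟩)
        (((psum y (j + 2) : ℕ) : ℤ) - ((psum n j : ℕ) : ℤ))

/-! ### The positive-discrete series -/

/-- The squared matrix elements `σ_n^{(α)}`. -/
def sigma (q α : ℝ) (n : ℕ) : ℝ :=
  q ^ (1 / 2 : ℝ) * ((1 - q ^ n) * (1 - q ^ ((n : ℝ) + α)) / (1 - q) ^ 2)

/-- The eigenvalue `n + (α + 1) / 2` of `A_0` on `e_n^{(α)}`. -/
def weight (α : ℝ) (n : ℕ) : ℝ := n + (α + 1) / 2

/-- The Casimir eigenvalue `γ(α)`. -/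
def gam (q α : ℝ) : ℝ :=
  (q ^ (α / 2) + q ^ (-α / 2)) / (q ^ (1 / 2 : ℝ) - q ^ (-1 / 2 : ℝ)) ^ 2

variable (𝕜 : Type*) [RCLike 𝕜]

/-- The underlying space of every `V^{(α)}`, with basis `e_n = Finsupp.single n 1`. -/
abbrev V : Type _ := ℕ →₀ 𝕜

/-- The operator `q^{c A_0}` on `V^{(α)}`. -/
def qA0 (q α c : ℝ) : Module.End 𝕜 (V 𝕜) :=
  Finsupp.linearCombination 𝕜 fun n =>
    ((q ^ (c * weight α n) : ℝ) : 𝕜) • (Finsupp.single n 1 : V 𝕜)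

/-- The operator `A_+` on `V^{(α)}`. -/
def Aplus (q α : ℝ) : Module.End 𝕜 (V 𝕜) :=
  Finsupp.linearCombination 𝕜 fun n =>
    ((√(sigma q α (n + 1)) : ℝ) : 𝕜) • (Finsupp.single (n + 1) 1 : V 𝕜)

/-- The operator `A_-` on `V^{(α)}`; it kills `e_0`, as `σ_0 = 0`. -/
def Aminus (q α : ℝ) : Module.End 𝕜 (V 𝕜) :=
  Finsupp.linearCombination 𝕜 fun n =>
    ((√(sigma q α n) : ℝ) : 𝕜) • (Finsupp.single (n - 1) 1 : V 𝕜)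

/-! ### The `d`-fold tensor product -/

/-- The underlying space of `W^{(α)} = V^{(α_1)} ⊗ ⋯ ⊗ V^{(α_d)}`. -/
abbrev W (d : ℕ) : Type _ := ⨂[𝕜] _ : Fin d, V 𝕜

/-- The direct product basis `e_y = e_{y_1} ⊗ ⋯ ⊗ e_{y_d}`. -/
def prodBasis (d : ℕ) : Module.Basis (Fin d → ℕ) 𝕜 (W 𝕜 d) :=
  Basis.piTensorProduct fun _ => Finsupp.basisSingleOne

theorem prodBasis_apply (d : ℕ) (y : Fin d → ℕ) :
    prodBasis 𝕜 d y = ⨂ₜ[𝕜] i, (Finsupp.single (y i) 1 : V 𝕜) := by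
  simp [prodBasis]

variable {𝕜}

/-- The inner product of `W^{(α)}`, for which the direct product basis is orthonormal. -/
def innerW {d : ℕ} (u v : W 𝕜 d) : 𝕜 :=
  ((prodBasis 𝕜 d).repr u).sum fun y c => conj c * (prodBasis 𝕜 d).repr v y

variable (𝕜)

/-- The operator `T^{(k)}`: `T` acting on the `k`-th tensor factor. -/
def site {d : ℕ} (k : Fin d) (T : Module.End 𝕜 (V 𝕜)) : Module.End 𝕜 (W 𝕜 d) :=
  PiTensorProduct.map (Function.update (fun _ => LinearMap.id) k T)

variable {d : ℕ} (q : ℝ) (α : Fin d → ℝ)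

/-- The operator `q^{c A_0^S}` on `W^{(α)}`, where `A_0^S = ∑_{k ∈ S} A_0^{(k)}`. -/
def qA0On (S : Finset (Fin d)) (c : ℝ) : Module.End 𝕜 (W 𝕜 d) :=
  PiTensorProduct.map fun k => if k ∈ S then qA0 𝕜 q (α k) c else LinearMap.id

/-- `A_+^S = ∑_{k ∈ S} q^{∑_{ℓ ∈ S, ℓ < k} A_0^{(ℓ)}} A_+^{(k)}`. -/
def AplusOn (S : Finset (Fin d)) : Module.End 𝕜 (W 𝕜 d) :=
  ∑ k ∈ S, qA0On 𝕜 q α {l ∈ S | l < k} 1 * site 𝕜 k (Aplus 𝕜 q (α k))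

/-- `A_-^S = ∑_{k ∈ S} q^{∑_{ℓ ∈ S, ℓ < k} A_0^{(ℓ)}} A_-^{(k)}`. -/
def AminusOn (S : Finset (Fin d)) : Module.End 𝕜 (W 𝕜 d) :=
  ∑ k ∈ S, qA0On 𝕜 q α {l ∈ S | l < k} 1 * site 𝕜 k (Aminus 𝕜 q (α k))

/-- The intermediate Casimir operator
`Γ^S = (q^{-1/2} q^{A_0^S} + q^{1/2} q^{-A_0^S}) / (q^{1/2} - q^{-1/2})² - A_+^S A_-^S q^{1 - A_0^S}`.
-/
def casimir (S : Finset (Fin d)) : Module.End 𝕜 (W 𝕜 d) :=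
  ((((q ^ (1 / 2 : ℝ) - q ^ (-1 / 2 : ℝ)) ^ 2)⁻¹ : ℝ) : 𝕜) •
      (((q ^ (-1 / 2 : ℝ) : ℝ) : 𝕜) • qA0On 𝕜 q α S 1
        + ((q ^ (1 / 2 : ℝ) : ℝ) : 𝕜) • qA0On 𝕜 q α S (-1))
    + (-1 : 𝕜) • (AplusOn 𝕜 q α S * AminusOn 𝕜 q α S * ((q : 𝕜) • qA0On 𝕜 q α S (-1)))

/-- The set `[1;k]`, as a set of (zero-based) indices in `Fin d`. -/
def initialSet (d k : ℕ) : Finset (Fin d) := {i | i.val < k}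

variable {𝕜}

/-- `g` is an orthonormal basis of `W^{(α)}` whose vectors `g_n` are joint eigenvectors of
`Γ^{[1;2]}, …, Γ^{[1;d]}` and `q^{A_0^{[1;d]}}`, with the eigenvalues
`γ(2 N_{k-1} + A_k + k - 1)`, `2 ≤ k ≤ d`, and `q^{N_d + (A_d + d)/2}`. -/
structure IsCoupledBasis (g : (Fin d → ℕ) → W 𝕜 d) : Prop where
  orthonormal : ∀ n n', innerW (g n) (g n') = if n = n' then 1 else 0
  span_eq_top : Submodule.span 𝕜 (Set.range g) = ⊤
  casimir_eigen : ∀ n, ∀ k ∈ Finset.Icc 2 d,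
    casimir 𝕜 q α (initialSet d k) (g n)
      = ((gam q (2 * ((psum n (k - 1) : ℕ) : ℝ) + psum α k + k - 1) : ℝ) : 𝕜) • g n
  qA0_eigen : ∀ n,
    qA0On 𝕜 q α (initialSet d d) 1 (g n)
      = ((q ^ (((psum n d : ℕ) : ℝ) + (psum α d + d) / 2) : ℝ) : 𝕜) • g n

/-- The two expansion formulas `g_n = ∑_y Ψ_n(y) e_y` and `e_y = ∑_n Ψ_n(y) g_n`
(sums with finitely many nonzero coefficients). -/
def HasPsiExpansions (g : (Fin d → ℕ) → W 𝕜 d) : Prop :=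
  (∀ n, g n = ∑ᶠ y, (Psi q α n y : 𝕜) • prodBasis 𝕜 d y) ∧
    ∀ y, prodBasis 𝕜 d y = ∑ᶠ n, (Psi q α n y : 𝕜) • g n

end SuQ

end

/-!
The coupled vectors arise by coupling one tensor factor at a time. The functions `ĥ_n(x, α, β, N)`
satisfy a raising and a lowering relation in `(x, N)`, which say that coupling the constituent of
parameter `α` with `V^{(β)}` through `ĥ_n` turns `A_±` on the product into `A_±` on the constituent
of parameter `2n + α + β + 1`. Hence `A_+ A_-` acts on `∑_y Ψ_n(y) e_y` by a scalar `σ`, and the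
Casimir operator by `γ`. The same two relations give the orthonormality of the `ĥ_n` by induction
on `N`: as `A_+` and `A_-` are adjoint to each other, the inner products in degree `N` reduce to
those in degree `N - 1`, and the norm of the lowest weight vector is a `q`-Chu–Vandermonde sum.
Finally `γ` is even and strictly monotone on `[0, ∞)`, so the joint eigenvalues separate the
indices `n` and a coupled basis is unique up to phases.
-/

namespace SuQ

open Finset.HasAntidiagonal (antidiagonal mem_antidiagonal)

section QPoch

variable {q : ℝ}

theorem qPoch_zero (a q : ℝ) : qPoch a q 0 = 1 :=
  Finset.prod_range_zero _

theorem qPoch_succ (a q : ℝ) (n : ℕ) : qPoch a q (n + 1) = qPoch a q n * (1 - a * q ^ n) :=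
  Finset.prod_range_succ _ n

theorem qPoch_succ' (a q : ℝ) (n : ℕ) : qPoch a q (n + 1) = (1 - a) * qPoch (a * q) q n := by
  rw [qPoch, Finset.prod_range_succ', pow_zero, mul_one, mul_comm]
  simp only [qPoch, mul_assoc, ← pow_succ']

theorem qPoch_add (a q : ℝ) (m n : ℕ) :
    qPoch a q (m + n) = qPoch a q m * qPoch (a * q ^ m) q n := by
  simp only [qPoch, Finset.prod_range_add, pow_add, mul_assoc]

theorem one_sub_mul_qPoch_mul (a q : ℝ) (n : ℕ) :
    (1 - a) * qPoch (a * q) q n = qPoch a q n * (1 - a * q ^ n) := by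
  rw [← qPoch_succ', qPoch_succ]

theorem qPoch_succ_sub_qPoch_succ_mul (a q : ℝ) (n : ℕ) :
    qPoch a q (n + 1) - qPoch (a * q) q (n + 1) = -a * (1 - q ^ (n + 1)) * qPoch (a * q) q n := by
  rw [qPoch_succ', qPoch_succ]; ring

theorem one_sub_mul_pow_pos (hq0 : 0 < q) (hq1 : q < 1) {A : ℝ} (hA : A < 1) (n : ℕ) :
    0 < 1 - A * q ^ n := by
  have hn : 0 < q ^ n := pow_pos hq0 n
  have hn' : q ^ n ≤ 1 := pow_le_one₀ hq0.le hq1.le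
  nlinarith

theorem qPoch_pos {a : ℝ} (hq0 : 0 < q) (hq1 : q < 1) (ha : a < 1) (n : ℕ) : 0 < qPoch a q n :=
  Finset.prod_pos fun i _ => one_sub_mul_pow_pos hq0 hq1 ha i

theorem qPoch_mul_pow_div_pos (hq0 : 0 < q) (hq1 : q < 1) {C : ℝ} (hC : C < 1) (n : ℕ) :
    0 < qPoch (C * q ^ n / q) q n := by
  cases n with
  | zero => simp [qPoch_zero]
  | succ n =>
    rw [pow_succ, ← mul_assoc, mul_div_cancel_right₀ _ hq0.ne']
    exact qPoch_pos hq0 hq1 (sub_pos.1 (one_sub_mul_pow_pos hq0 hq1 hC n)) _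

theorem qPoch_self_ne_zero (hq0 : 0 < q) (hq1 : q < 1) (n : ℕ) : qPoch q q n ≠ 0 :=
  (qPoch_pos hq0 hq1 hq1 n).ne'

theorem qPoch_inv_pow_eq_zero (hq : q ≠ 0) {n k : ℕ} (h : n < k) : qPoch (q ^ n)⁻¹ q k = 0 := by
  refine Finset.prod_eq_zero (Finset.mem_range.2 h) ?_
  rw [inv_mul_cancel₀ (pow_ne_zero n hq), sub_self]

theorem qPoch_inv_pow_ne_zero (hq0 : 0 < q) (hq1 : q < 1) {n k : ℕ} (h : k ≤ n) :
    qPoch (q ^ n)⁻¹ q k ≠ 0 := by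
  refine Finset.prod_ne_zero_iff.2 fun i hi => ?_
  have hin : q ^ n < q ^ i :=
    pow_lt_pow_right_of_lt_one₀ hq0 hq1 ((Finset.mem_range.1 hi).trans_le h)
  rw [sub_ne_zero, ne_comm, inv_mul_eq_div, ne_eq, div_eq_one_iff_eq (pow_pos hq0 n).ne']
  exact hin.ne'

theorem inv_pow_succ_mul_self (hq : q ≠ 0) (n : ℕ) : (q ^ (n + 1))⁻¹ * q = (q ^ n)⁻¹ := by
  rw [pow_succ]
  field_simp

theorem qPoch_inv_pow_self_sq (hq : q ≠ 0) (n : ℕ) :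
    qPoch (q ^ n)⁻¹ q n ^ 2 * q ^ (n * (n + 1)) = qPoch q q n ^ 2 := by
  induction n with
  | zero => simp [qPoch_zero]
  | succ n ih =>
    have hstep : (1 - (q ^ (n + 1))⁻¹) ^ 2 * (q ^ (n + 1)) ^ 2 = (1 - q * q ^ n) ^ 2 := by
      field_simp
      ring
    rw [qPoch_succ', qPoch_succ, inv_pow_succ_mul_self hq, mul_pow, mul_pow, ← ih,
      show (n + 1) * (n + 1 + 1) = n * (n + 1) + (n + 1) * 2 by ring, pow_add q (n * (n + 1)),
      pow_mul q (n + 1) 2]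
    linear_combination qPoch (q ^ n)⁻¹ q n ^ 2 * q ^ (n * (n + 1)) * hstep

theorem one_sub_pow_succ_ne_zero (hq0 : 0 < q) (hq1 : q < 1) (n : ℕ) : 1 - q ^ (n + 1) ≠ 0 :=
  (sub_pos.2 (pow_lt_one₀ hq0.le hq1 n.succ_ne_zero)).ne'

-- `1 - q ^ (x + r) = (1 - q ^ r) + q ^ r * (1 - q ^ x)`, and each part cancels a factor below it.
theorem sum_antidiagonal_succ_div_qPoch (hq0 : 0 < q) (hq1 : q < 1) (f : ℕ → ℕ → ℝ) (n : ℕ) :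
    (1 - q ^ (n + 1)) *
        ∑ p ∈ antidiagonal (n + 1), f p.1 p.2 / (qPoch q q p.1 * qPoch q q p.2)
      = ∑ p ∈ antidiagonal n,
          (f p.1 (p.2 + 1) + q ^ p.2 * f (p.1 + 1) p.2) / (qPoch q q p.1 * qPoch q q p.2) := by
  have hcancel (k : ℕ) (c : ℝ) : (1 - q ^ (k + 1)) * (c / qPoch q q (k + 1)) = c / qPoch q q k := by
    have := one_sub_pow_succ_ne_zero hq0 hq1 k
    have := qPoch_self_ne_zero hq0 hq1 k
    rw [qPoch_succ, ← pow_succ']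
    field_simp
  have hsplit : ∀ p ∈ antidiagonal (n + 1),
      (1 - q ^ (n + 1)) * (f p.1 p.2 / (qPoch q q p.1 * qPoch q q p.2))
        = (1 - q ^ p.2) * (f p.1 p.2 / qPoch q q p.1 / qPoch q q p.2)
          + q ^ p.2 * ((1 - q ^ p.1) * (f p.1 p.2 / qPoch q q p.2 / qPoch q q p.1)) := by
    intro p hp
    rw [← mem_antidiagonal.1 hp]
    ring
  rw [Finset.mul_sum, Finset.sum_congr rfl hsplit, Finset.sum_add_distrib,
    Finset.Nat.sum_antidiagonal_succ', Finset.Nat.sum_antidiagonal_succ]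
  simp only [hcancel, pow_zero, sub_self, zero_mul, mul_zero, zero_add, ← Finset.sum_add_distrib]
  exact Finset.sum_congr rfl fun p _ => by ring

/-- The numerators of the summands, indexed by `x + r = n`, in the `q`-Chu–Vandermonde summation
`sum_antidiagonal_vandermondeTerm`. -/
noncomputable def vandermondeTerm (q A B : ℝ) (x r : ℕ) : ℝ :=
  qPoch (A * q ^ x) q r * qPoch (B * q ^ r) q x * (q ^ (x * (x - 1)) * A ^ x)

theorem vandermondeTerm_succ_right_add (q A B : ℝ) (x r : ℕ) :
    vandermondeTerm q A B x (r + 1) + q ^ r * vandermondeTerm q A B (x + 1) r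
      = (1 - A * q ^ (x + r)) * vandermondeTerm q A (B * q) x r
        + A * q ^ (x + r) * (1 - B * q ^ (x + r)) * vandermondeTerm q (A * q) B x r := by
  have hpow : q ^ ((x + 1) * x) = q ^ (x * (x - 1)) * q ^ x * q ^ x := by
    cases x with
    | zero => simp
    | succ x => rw [← pow_add, ← pow_add, Nat.add_sub_cancel]; congr 1; ring
  simp only [vandermondeTerm, qPoch_succ, Nat.add_sub_cancel, hpow,
    show B * q ^ (r + 1) = B * q * q ^ r by ring, show A * q ^ (x + 1) = A * q * q ^ x by ring]
  ring

theorem sum_antidiagonal_vandermondeTerm (hq0 : 0 < q) (hq1 : q < 1) (A B : ℝ) (n : ℕ) :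
    ∑ p ∈ antidiagonal n, vandermondeTerm q A B p.1 p.2 / (qPoch q q p.1 * qPoch q q p.2)
      = qPoch (A * B * q ^ n / q) q n / qPoch q q n := by
  induction n generalizing A B with
  | zero => simp [vandermondeTerm, qPoch_zero]
  | succ n ih =>
    have hq := one_sub_pow_succ_ne_zero hq0 hq1 n
    have hn := qPoch_self_ne_zero hq0 hq1 n
    have hstep : (1 - q ^ (n + 1)) * ∑ p ∈ antidiagonal (n + 1),
          vandermondeTerm q A B p.1 p.2 / (qPoch q q p.1 * qPoch q q p.2)
        = (1 - A * q ^ n) * (qPoch (A * (B * q) * q ^ n / q) q n / qPoch q q n)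
          + A * q ^ n * (1 - B * q ^ n) * (qPoch (A * q * B * q ^ n / q) q n / qPoch q q n) := by
      rw [sum_antidiagonal_succ_div_qPoch hq0 hq1, ← ih, ← ih, Finset.mul_sum, Finset.mul_sum,
        ← Finset.sum_add_distrib]
      refine Finset.sum_congr rfl fun p hp => ?_
      rw [vandermondeTerm_succ_right_add, mem_antidiagonal.1 hp]
      ring
    rw [← mul_right_inj' hq, hstep, show A * (B * q) * q ^ n / q = A * B * q ^ n by field_simp,
      show A * q * B * q ^ n / q = A * B * q ^ n by field_simp,
      show A * B * q ^ (n + 1) / q = A * B * q ^ n by rw [pow_succ]; field_simp, qPoch_succ,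
      qPoch_succ q, ← pow_succ' q]
    field_simp
    ring

end QPoch

section HahnPoly

/-- The coefficients of `hahnPoly` with respect to the products `(X;q)_k (Z q^k;q)_{n-k}`. -/
noncomputable def hahnCoeff (q A B : ℝ) (n k : ℕ) : ℝ :=
  qPoch (q ^ n)⁻¹ q k * qPoch (A * B * q ^ n / q) q k / qPoch q q k * q ^ k
    * qPoch (A * q ^ k) q (n - k)

/-- The `q`-Hahn polynomial as a polynomial in `X = q ^ (-x)` and `Z = q ^ (-N)`, with parameters
`A = q ^ (α + 1)` and `B = q ^ (β + 1)`. The prefactors of `hahn` have been multiplied into the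
series, so that nothing is divided by a function of `A` or `Z`. -/
noncomputable def hahnPoly (q A B : ℝ) (n : ℕ) (X Z : ℝ) : ℝ :=
  ∑ k ∈ Finset.range (n + 1), hahnCoeff q A B n k * (qPoch X q k * qPoch (Z * q ^ k) q (n - k))

variable {q : ℝ}

theorem hahnPoly_raising (q A B : ℝ) (n : ℕ) (X Z : ℝ) :
    (X - 1) * Z * hahnPoly q A B n (X * q) (Z * q) + (Z - X) * hahnPoly q A B n X (Z * q)
      = X * (Z * q ^ n - 1) * hahnPoly q A B n X Z := by
  simp only [hahnPoly, Finset.mul_sum, ← Finset.sum_add_distrib]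
  refine Finset.sum_congr rfl fun k hk => ?_
  obtain ⟨r, rfl⟩ := Nat.exists_eq_add_of_le (Nat.lt_succ_iff.1 (Finset.mem_range.1 hk))
  rw [Nat.add_sub_cancel_left, pow_add, mul_right_comm Z q]
  linear_combination
    -hahnCoeff q A B (k + r) k * Z * qPoch (Z * q ^ k * q) q r * one_sub_mul_qPoch_mul X q k
      - hahnCoeff q A B (k + r) k * X * qPoch X q k * one_sub_mul_qPoch_mul (Z * q ^ k) q r

theorem hahnPoly_raising_pow (hq : q ≠ 0) (A B : ℝ) {n x y r : ℕ} (h : x + y = n + r + 1) :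
    (1 - q ^ x) * hahnPoly q A B n ((q ^ x)⁻¹ * q) (q ^ (n + r))⁻¹
        + q ^ x * (1 - q ^ y) * hahnPoly q A B n (q ^ x)⁻¹ (q ^ (n + r))⁻¹
      = q ^ n * (1 - q ^ (r + 1)) * hahnPoly q A B n (q ^ x)⁻¹ (q ^ (n + r + 1))⁻¹ := by
  have hrec := hahnPoly_raising q A B n (q ^ x)⁻¹ (q ^ (n + r + 1))⁻¹
  have hpow : q ^ (n + r + 1) = q ^ x * q ^ y := by rw [← pow_add, h]
  have hpow' : q ^ x * q ^ y = q ^ n * q ^ (r + 1) := by rw [← pow_add, ← pow_add, h, add_assoc]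
  rw [inv_pow_succ_mul_self hq] at hrec
  generalize hahnPoly q A B n ((q ^ x)⁻¹ * q) (q ^ (n + r))⁻¹ = P₁ at *
  generalize hahnPoly q A B n (q ^ x)⁻¹ (q ^ (n + r))⁻¹ = P₂ at *
  generalize hahnPoly q A B n (q ^ x)⁻¹ (q ^ (n + r + 1))⁻¹ = P₃ at *
  rw [hpow] at hrec
  field_simp at hrec
  linear_combination hrec - P₃ * hpow'

theorem hahnCoeff_succ (hq0 : 0 < q) (hq1 : q < 1) (A B : ℝ) (k r : ℕ) :
    hahnCoeff q A B (k + r + 1) (k + 1) * (1 - A * q ^ k) * (1 - q ^ (k + 1))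
      = hahnCoeff q A B (k + r + 1) k * (1 - (q ^ (r + 1))⁻¹) *
        (q - A * B * q ^ (k + r + 1 + k)) := by
  have hk := qPoch_self_ne_zero hq0 hq1 k
  have hk' := one_sub_pow_succ_ne_zero hq0 hq1 k
  have hq := hq0.ne'
  rw [hahnCoeff, hahnCoeff, show k + r + 1 - k = r + 1 by omega,
    show k + r + 1 - (k + 1) = r by omega, qPoch_succ' (A * q ^ k), qPoch_succ, qPoch_succ,
    qPoch_succ, ← pow_succ' q, show A * q ^ (k + 1) = A * q ^ k * q by ring]
  generalize qPoch (q ^ (k + r + 1))⁻¹ q k = u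
  generalize qPoch (A * B * q ^ (k + r + 1) / q) q k = v
  generalize 1 - q ^ (k + 1) = c at *
  field_simp
  ring

-- Summation of `hahnPoly_lowering_term` against `hahnCoeff q A B n k` telescopes, by
-- `hahnCoeff_mul_lowering_term`.
theorem hahnPoly_lowering_term (hq : q ≠ 0) (A B X Z : ℝ) (k r : ℕ) :
    Z * (q * X - A) * (qPoch X q k * qPoch (Z * q ^ k) q r)
        + A * (Z - B * X) * (qPoch (X * q) q k * qPoch (Z * q ^ k) q r)
        - (q ^ (k + r))⁻¹ * X * (q * Z - A * B * q ^ (k + r)) *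
          (qPoch (X * q) q k * qPoch (Z * q * q ^ k) q r)
      = (q ^ (k + r))⁻¹ * (q ^ k)⁻¹ * X * (q - A * B * q ^ (k + r + k)) * qPoch (X * q) q k *
          (qPoch (Z * q ^ k) q r - qPoch (Z * q ^ k * q) q r)
        - Z * (q ^ k)⁻¹ * (q - A * q ^ k) * (qPoch (X * q) q k - qPoch X q k) *
          qPoch (Z * q ^ k) q r := by
  rw [mul_right_comm Z q]
  have hX := one_sub_mul_qPoch_mul X q k
  have hZ := one_sub_mul_qPoch_mul (Z * q ^ k) q r
  generalize qPoch (X * q) q k = x' at *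
  generalize qPoch X q k = x at *
  generalize qPoch (Z * q ^ k * q) q r = z' at *
  generalize qPoch (Z * q ^ k) q r = z at *
  rw [pow_add q (k + r), pow_add q k r]
  have hs : q ^ k ≠ 0 := pow_ne_zero k hq
  have ht : q ^ r ≠ 0 := pow_ne_zero r hq
  generalize q ^ k = s at *
  generalize q ^ r = t at *
  field_simp
  linear_combination s * t * Z * z * q * hX + q * X * x' * hZ

theorem hahnCoeff_mul_lowering_term (hq0 : 0 < q) (hq1 : q < 1) (A B X Z : ℝ) (k r : ℕ) :
    hahnCoeff q A B (k + r + 1) k *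
        ((q ^ (k + r + 1))⁻¹ * (q ^ k)⁻¹ * X * (q - A * B * q ^ (k + r + 1 + k)) *
          qPoch (X * q) q k * (qPoch (Z * q ^ k) q (r + 1) - qPoch (Z * q ^ k * q) q (r + 1)))
      = hahnCoeff q A B (k + r + 1) (k + 1) *
          (Z * (q ^ (k + 1))⁻¹ * (q - A * q ^ (k + 1)) *
            (qPoch (X * q) q (k + 1) - qPoch X q (k + 1)) * qPoch (Z * q ^ (k + 1)) q r) := by
  have hcoeff := hahnCoeff_succ hq0 hq1 A B k r
  have hpow : (q ^ (k + r + 1))⁻¹ = (q ^ k)⁻¹ * (q ^ (r + 1))⁻¹ := by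
    rw [add_assoc, pow_add, mul_inv]
  have hk : q ^ k ≠ 0 := pow_ne_zero k hq0.ne'
  have hr : q ^ (r + 1) ≠ 0 := pow_ne_zero _ hq0.ne'
  have hq := hq0.ne'
  rw [← neg_sub (qPoch X q (k + 1)), qPoch_succ_sub_qPoch_succ_mul, qPoch_succ_sub_qPoch_succ_mul,
    hpow, mul_assoc Z _ q, ← pow_succ]
  calc _ = Z * (q ^ k)⁻¹ * X * qPoch (X * q) q k * qPoch (Z * q ^ (k + 1)) q r *
        (hahnCoeff q A B (k + r + 1) k * (1 - (q ^ (r + 1))⁻¹) *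
          (q - A * B * q ^ (k + r + 1 + k))) := by field_simp; ring
    _ = _ := by rw [← hcoeff, pow_succ q k]; field_simp

theorem hahnPoly_lowering (hq0 : 0 < q) (hq1 : q < 1) (A B : ℝ) (n : ℕ) (X Z : ℝ) :
    Z * (q * X - A) * hahnPoly q A B n X Z + A * (Z - B * X) * hahnPoly q A B n (X * q) Z
      = (q ^ n)⁻¹ * X * (q * Z - A * B * q ^ n) * hahnPoly q A B n (X * q) (Z * q) := by
  let U (k : ℕ) : ℝ := hahnCoeff q A B n k *
    ((q ^ n)⁻¹ * (q ^ k)⁻¹ * X * (q - A * B * q ^ (n + k)) * qPoch (X * q) q k *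
      (qPoch (Z * q ^ k) q (n - k) - qPoch (Z * q ^ k * q) q (n - k)))
  let L (k : ℕ) : ℝ := hahnCoeff q A B n k *
    (Z * (q ^ k)⁻¹ * (q - A * q ^ k) * (qPoch (X * q) q k - qPoch X q k) *
      qPoch (Z * q ^ k) q (n - k))
  have hUL : ∀ k ∈ Finset.range n, U k = L (k + 1) := by
    intro k hk
    obtain ⟨r, rfl⟩ := Nat.exists_eq_add_of_lt (Finset.mem_range.1 hk)
    simp only [U, L, show k + r + 1 - k = r + 1 by omega, show k + r + 1 - (k + 1) = r by omega]
    exact hahnCoeff_mul_lowering_term hq0 hq1 A B X Z k r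
  have htelescope : ∑ k ∈ Finset.range (n + 1), (U k - L k) = 0 := by
    have hU : U n = 0 := by simp [U, qPoch_zero]
    have hL : L 0 = 0 := by simp [L, qPoch_zero]
    rw [Finset.sum_sub_distrib, Finset.sum_range_succ, Finset.sum_range_succ',
      Finset.sum_congr rfl hUL, hU, hL, sub_self]
  rw [← sub_eq_zero, ← htelescope]
  simp only [hahnPoly, Finset.mul_sum, ← Finset.sum_add_distrib, ← Finset.sum_sub_distrib]
  refine Finset.sum_congr rfl fun k hk => ?_
  obtain ⟨r, rfl⟩ := Nat.exists_eq_add_of_le (Nat.lt_succ_iff.1 (Finset.mem_range.1 hk))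
  simp only [U, L, Nat.add_sub_cancel_left]
  linear_combination hahnCoeff q A B (k + r) k * hahnPoly_lowering_term hq0.ne' A B X Z k r

theorem hahnPoly_eq_zero (hq : q ≠ 0) (A B : ℝ) (x r : ℕ) :
    hahnPoly q A B (x + r + 1) (q ^ x)⁻¹ (q ^ (x + r))⁻¹ = 0 := by
  refine Finset.sum_eq_zero fun k _ => ?_
  obtain hxk | hkx := Nat.lt_or_ge x k
  · rw [qPoch_inv_pow_eq_zero hq hxk, zero_mul, mul_zero]
  · obtain ⟨s, rfl⟩ := Nat.exists_eq_add_of_le hkx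
    have hZ : (q ^ (k + s + r))⁻¹ * q ^ k = (q ^ (s + r))⁻¹ := by
      rw [add_assoc, pow_add]
      field_simp
    rw [hZ, qPoch_inv_pow_eq_zero (n := s + r) hq (by omega), mul_zero, mul_zero]

theorem hahnPoly_lowering_pow (hq0 : 0 < q) (hq1 : q < 1) (A B : ℝ) (n x y : ℕ) :
    q ^ n * ((1 - A * q ^ x) * hahnPoly q A B n (q ^ (x + 1))⁻¹ (q ^ (x + y + 1))⁻¹
        + q ^ x * A * (1 - B * q ^ y) * hahnPoly q A B n (q ^ x)⁻¹ (q ^ (x + y + 1))⁻¹)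
      = (1 - A * B * q ^ (n + (x + y))) * hahnPoly q A B n (q ^ x)⁻¹ (q ^ (x + y))⁻¹ := by
  have hrec := hahnPoly_lowering hq0 hq1 A B n (q ^ (x + 1))⁻¹ (q ^ (x + y + 1))⁻¹
  have hq := hq0.ne'
  rw [inv_pow_succ_mul_self hq, inv_pow_succ_mul_self hq] at hrec
  generalize hahnPoly q A B n (q ^ (x + 1))⁻¹ (q ^ (x + y + 1))⁻¹ = P₁ at *
  generalize hahnPoly q A B n (q ^ x)⁻¹ (q ^ (x + y + 1))⁻¹ = P₂ at *
  generalize hahnPoly q A B n (q ^ x)⁻¹ (q ^ (x + y))⁻¹ = P₃ at *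
  rw [show q ^ (x + y + 1) = q ^ x * q ^ y * q by ring] at hrec
  rw [show q ^ (n + (x + y)) = q ^ n * q ^ x * q ^ y by ring]
  field_simp at hrec
  exact mul_left_cancel₀ hq (by linear_combination hrec)

theorem hahnPoly_one (q A B : ℝ) (n : ℕ) (Z : ℝ) :
    hahnPoly q A B n 1 Z = qPoch A q n * qPoch Z q n := by
  rw [hahnPoly, Finset.sum_eq_single_of_mem 0 (by simp)]
  · simp [hahnCoeff, qPoch_zero]
  · intro k _ hk
    obtain ⟨k, rfl⟩ := Nat.exists_eq_succ_of_ne_zero hk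
    simp [qPoch_succ']

theorem hahnPoly_self (hq0 : 0 < q) (hq1 : q < 1) {A : ℝ} (hA : A < 1) (B : ℝ) (x y : ℕ) :
    hahnPoly q A B (x + y) (q ^ x)⁻¹ (q ^ (x + y))⁻¹ =
      (-A) ^ x * q ^ x.choose 2 * (qPoch (A * q ^ x) q y * qPoch (B * q ^ y) q x) *
        qPoch (q ^ (x + y))⁻¹ q (x + y) := by
  induction x generalizing y with
  | zero => simp [hahnPoly_one, qPoch_zero]
  | succ x ih =>
    have hrec := hahnPoly_lowering_pow hq0 hq1 A B (x + y + 1) x y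
    have hq := hq0.ne'
    rw [hahnPoly_eq_zero hq, mul_zero, mul_eq_zero, or_iff_right (pow_ne_zero _ hq), add_assoc x y,
      ih, qPoch_succ' (A * q ^ x)] at hrec
    rw [add_right_comm, add_assoc x y 1, qPoch_succ' (B * q ^ y), Nat.choose_succ_succ' x 1,
      Nat.choose_one_right, pow_add q x (x.choose 2), pow_succ (-A), pow_succ q x, ← mul_assoc A,
      ← pow_succ q x]
    rw [pow_succ q y, ← mul_assoc B] at hrec
    refine mul_left_cancel₀ (one_sub_mul_pow_pos hq0 hq1 hA x).ne' ?_
    linear_combination hrec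

theorem rpow_neg_natCast_eq_inv_pow (hq : 0 ≤ q) (n : ℕ) : q ^ (-(n : ℝ)) = (q ^ n)⁻¹ := by
  rw [Real.rpow_neg hq, Real.rpow_natCast]

theorem hahn_eq_hahnPoly (hq0 : 0 < q) (hq1 : q < 1) {n N : ℕ} {a : ℝ} (ha : -1 < a)
    (hn : n ≤ N) (x : ℕ) (b : ℝ) :
    hahn q n x a b N = hahnPoly q (q ^ (a + 1)) (q ^ (b + 1)) n (q ^ x)⁻¹ (q ^ N)⁻¹ := by
  have hA : q ^ (a + 1) < 1 := Real.rpow_lt_one hq0.le hq1 (by linarith)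
  have hAB : q ^ ((n : ℝ) + a + b + 1) = q ^ (a + 1) * q ^ (b + 1) * q ^ n / q := by
    rw [← Real.rpow_natCast, ← Real.rpow_add hq0, ← Real.rpow_add hq0, ← Real.rpow_sub_one hq0.ne']
    congr 1
    ring
  have hterminate : ∀ k ∉ Finset.range (n + 1), qPoch (q ^ n)⁻¹ q k = 0 := fun k hk =>
    qPoch_inv_pow_eq_zero hq0.ne' (by simpa using hk)
  simp only [hahn, basicHypergeometric, rpow_neg_natCast_eq_inv_pow hq0.le, hAB]
  rw [tsum_eq_sum (s := Finset.range (n + 1)) fun k hk => by simp [hterminate k hk], hahnPoly,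
    Finset.mul_sum]
  refine Finset.sum_congr rfl fun k hk => ?_
  obtain ⟨r, rfl⟩ := Nat.exists_eq_add_of_le (Nat.lt_succ_iff.1 (Finset.mem_range.1 hk))
  have hAk := (qPoch_pos hq0 hq1 hA k).ne'
  have hZk := qPoch_inv_pow_ne_zero hq0 hq1 (show k ≤ N by omega)
  have hqk := qPoch_self_ne_zero hq0 hq1 k
  rw [qPoch_add _ _ k r, qPoch_add (q ^ N)⁻¹ _ k r, hahnCoeff, Nat.add_sub_cancel_left]
  simp only [List.map_cons, List.map_nil, List.prod_cons, List.prod_nil, List.length_cons,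
    List.length_nil]
  generalize qPoch (q ^ N)⁻¹ q k = z at *
  generalize qPoch q q k = w at *
  norm_num
  field_simp

end HahnPoly

section MatrixElements

variable {q : ℝ}

theorem sigma_zero (q a : ℝ) : sigma q a 0 = 0 := by simp [sigma]

theorem sigma_succ_pos (hq0 : 0 < q) (hq1 : q < 1) {a : ℝ} (ha : -1 < a) (n : ℕ) :
    0 < sigma q a (n + 1) := by
  have hexp : 0 < ((n + 1 : ℕ) : ℝ) + a := by
    have := n.cast_nonneg (α := ℝ)
    push_cast
    linarith
  have hn : 0 < 1 - q ^ (n + 1) := sub_pos.2 (pow_lt_one₀ hq0.le hq1 n.succ_ne_zero)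
  have ha' : 0 < 1 - q ^ (((n + 1 : ℕ) : ℝ) + a) := sub_pos.2 (Real.rpow_lt_one hq0.le hq1 hexp)
  have : 0 < 1 - q := sub_pos.2 hq1
  unfold sigma
  positivity

theorem sigma_nonneg (hq0 : 0 < q) (hq1 : q < 1) {a : ℝ} (ha : -1 < a) (n : ℕ) :
    0 ≤ sigma q a n := by
  cases n with
  | zero => exact (sigma_zero q a).ge
  | succ n => exact (sigma_succ_pos hq0 hq1 ha n).le

/-- The constant by which `√(sigma q a n)` exceeds `√((1 - q ^ n) * (1 - q ^ (n + a)))`. -/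
noncomputable def ladderScale (q : ℝ) : ℝ := √(q ^ (1 / 2 : ℝ)) / (1 - q)

theorem sigma_eq (hq0 : 0 < q) (a : ℝ) (n : ℕ) :
    sigma q a n = ladderScale q ^ 2 * ((1 - q ^ n) * (1 - q ^ a * q ^ n)) := by
  rw [sigma, ladderScale, div_pow, Real.sq_sqrt (Real.rpow_nonneg hq0.le _), Real.rpow_add hq0,
    Real.rpow_natCast]
  ring

theorem sqrt_sigma_succ (hq0 : 0 < q) (hq1 : q < 1) (a : ℝ) (n : ℕ) :
    √(sigma q a (n + 1)) = ladderScale q * √((1 - q ^ (n + 1)) * (1 - q ^ (a + 1) * q ^ n)) := by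
  have hscale : 0 ≤ ladderScale q := div_nonneg (Real.sqrt_nonneg _) (sub_nonneg.2 hq1.le)
  rw [sigma_eq hq0, Real.sqrt_mul (sq_nonneg _), Real.sqrt_sq hscale, Real.rpow_add_one hq0.ne',
    pow_succ']
  ring_nf

theorem sqrt_mul_sqrt_of_mul_eq_mul {p r u v : ℝ} (hp : 0 ≤ p) (hr : 0 ≤ r) (h : v * p = u * r) :
    √(p * r) * √u = p * √v := by
  rw [← Real.sqrt_mul (mul_nonneg hp hr), show p * r * u = p ^ 2 * v by linear_combination -p * h,
    Real.sqrt_mul (sq_nonneg p), Real.sqrt_sq hp]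

end MatrixElements

section HahnWeight

variable {q a b : ℝ}

theorem rpow_add_one_lt_one (hq0 : 0 < q) (hq1 : q < 1) (ha : -1 < a) : q ^ (a + 1) < 1 :=
  Real.rpow_lt_one hq0.le hq1 (by linarith)

theorem rpow_add_one_mul_rpow_add_one_lt_one (hq0 : 0 < q) (hq1 : q < 1) (ha : -1 < a)
    (hb : -1 < b) : q ^ (a + 1) * q ^ (b + 1) < 1 :=
  mul_lt_one_of_nonneg_of_lt_one_left (Real.rpow_nonneg hq0.le _)
    (rpow_add_one_lt_one hq0 hq1 ha) (rpow_add_one_lt_one hq0 hq1 hb).le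

theorem one_sub_pow_nonneg (hq0 : 0 < q) (hq1 : q < 1) (n : ℕ) : 0 ≤ 1 - q ^ n :=
  sub_nonneg.2 (pow_le_one₀ hq0.le hq1.le)

theorem hahnWeight_pos (hq0 : 0 < q) (hq1 : q < 1) (ha : -1 < a) (hb : -1 < b) (x N : ℕ) :
    0 < hahnWeight q x a b N := by
  have hA := qPoch_pos hq0 hq1 (rpow_add_one_lt_one hq0 hq1 ha) x
  have hB := qPoch_pos hq0 hq1 (rpow_add_one_lt_one hq0 hq1 hb) (N - x)
  have hx := qPoch_pos hq0 hq1 hq1 x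
  have hN := qPoch_pos hq0 hq1 hq1 (N - x)
  unfold hahnWeight
  positivity

theorem hahnWeight_add (hq : 0 ≤ q) (a b : ℝ) (x y : ℕ) : hahnWeight q x a b (x + y) =
    qPoch (q ^ (a + 1)) q x * qPoch (q ^ (b + 1)) q y / (qPoch q q x * qPoch q q y)
      * (q ^ (a + 1)) ^ y := by
  rw [hahnWeight, Nat.add_sub_cancel_left, ← Real.rpow_mul_natCast hq]
  congr 2
  push_cast
  ring

theorem hahnWeight_succ_left (hq0 : 0 < q) (hq1 : q < 1) (a b : ℝ) (x y : ℕ) :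
    hahnWeight q (x + 1) a b (x + 1 + y) * (1 - q ^ (x + 1))
      = hahnWeight q x a b (x + y) * (1 - q ^ (a + 1) * q ^ x) := by
  have hx := one_sub_pow_succ_ne_zero hq0 hq1 x
  rw [hahnWeight_add hq0.le, hahnWeight_add hq0.le, qPoch_succ, qPoch_succ, ← pow_succ' q]
  field_simp

theorem hahnWeight_succ_right (hq0 : 0 < q) (hq1 : q < 1) (a b : ℝ) (x y : ℕ) :
    hahnWeight q x a b (x + (y + 1)) * (1 - q ^ (y + 1))
      = q ^ (a + 1) * hahnWeight q x a b (x + y) * (1 - q ^ (b + 1) * q ^ y) := by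
  have hy := one_sub_pow_succ_ne_zero hq0 hq1 y
  rw [hahnWeight_add hq0.le, hahnWeight_add hq0.le, qPoch_succ, qPoch_succ, ← pow_succ' q]
  rw [pow_succ (q ^ (a + 1))]
  field_simp

end HahnWeight

section HahnNorm

variable {q a b : ℝ}

theorem one_sub_rpow_mul_pow_ne_zero (hq0 : 0 < q) (hq1 : q < 1) {c : ℝ} (hc : -1 < c)
    (hc0 : c ≠ 0) (n : ℕ) : 1 - q ^ c * q ^ n ≠ 0 := by
  have hexp : c + n ≠ 0 := by
    cases n with
    | zero => simpa using hc0
    | succ n =>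
      have := n.cast_nonneg (α := ℝ)
      push_cast
      linarith
  rw [← Real.rpow_natCast, ← Real.rpow_add hq0, sub_ne_zero, ← Real.rpow_zero q]
  exact fun h => hexp ((Real.rpow_right_inj hq0 hq1.ne).1 h.symm)

-- For `C = q ^ (α + β + 1)` one has `(1 - C) (C q;q)_{2n+r} = (C;q)_{2n+r+1}`, and the factors
-- `(C;q)_n` and `1 - C q ^ (2 n)` of the right-hand side cancel.
theorem hahnNorm_add (hq0 : 0 < q) (hq1 : q < 1) (hab : -1 < a + b + 1) (hab0 : a + b + 1 ≠ 0)
    (n r : ℕ) :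
    hahnNorm q n a b (n + r) =
      qPoch (q ^ (a + 1) * q ^ (b + 1) * q ^ n / q) q n *
        qPoch (q ^ (a + 1) * q ^ (b + 1) * q ^ (2 * n)) q r / qPoch q q r *
        (qPoch q q n * qPoch (q ^ (a + 1)) q n * qPoch (q ^ (b + 1)) q n * (q ^ (a + 1)) ^ n) /
        (q ^ (n * (n + 1)) * q ^ (2 * n * r)) := by
  set C := q ^ (a + b + 1) with hCdef
  have hAB : q ^ (a + 1) * q ^ (b + 1) = C * q := by
    rw [hCdef, ← Real.rpow_add hq0, ← Real.rpow_add_one hq0.ne']; congr 1; ring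
  have hC (i : ℕ) : 1 - C * q ^ i ≠ 0 := one_sub_rpow_mul_pow_ne_zero hq0 hq1 hab hab0 i
  have hCn : qPoch C q n ≠ 0 := Finset.prod_ne_zero_iff.2 fun i _ => hC i
  have hsplit : (1 - C) * qPoch (C * q) q (n + (n + r)) = qPoch C q n * qPoch (C * q ^ n) q n *
      ((1 - C * q ^ (2 * n)) * qPoch (C * q ^ (2 * n) * q) q r) := by
    rw [← qPoch_succ', ← qPoch_succ', two_mul, pow_add, ← mul_assoc C, mul_assoc (qPoch C q n),
      ← qPoch_add, ← qPoch_add]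
    rfl
  have hpow : q ^ (2 * (n.choose 2 : ℝ) - 2 * ((n + r : ℕ) : ℝ) * n)
      = (q ^ (n * (n + 1)) * q ^ (2 * n * r))⁻¹ := by
    rw [← pow_add, ← rpow_neg_natCast_eq_inv_pow hq0.le, Nat.cast_choose_two]
    congr 1
    push_cast
    ring
  have hC2n : q ^ (2 * (n : ℝ) + a + b + 1) = C * q ^ (2 * n) := by
    rw [hCdef, ← Real.rpow_natCast, ← Real.rpow_add hq0]; congr 1; push_cast; ring
  have hCq : q ^ (a + b + 2) = C * q := by
    rw [hCdef, ← Real.rpow_add_one hq0.ne']; congr 1; ring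
  have hq := hq0.ne'
  rw [hahnNorm, Nat.add_sub_cancel_left, hpow, hC2n, hCq, ← hCdef, mul_comm (n : ℝ),
    Real.rpow_mul_natCast hq0.le, hAB, mul_right_comm C q, mul_div_cancel_right₀ _ hq,
    mul_right_comm C q]
  have h2n := hC (2 * n)
  have hr := qPoch_self_ne_zero hq0 hq1 r
  generalize qPoch (C * q) q (n + (n + r)) = P at *
  generalize qPoch (C * q ^ (2 * n) * q) q r = S at *
  generalize qPoch q q n * qPoch (q ^ (a + 1)) q n * qPoch (q ^ (b + 1)) q n = K
  field_simp
  linear_combination K * hsplit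

theorem hahnNorm_pos (hq0 : 0 < q) (hq1 : q < 1) (ha : -1 < a) (hb : -1 < b)
    (hab : a + b + 1 ≠ 0) (n r : ℕ) : 0 < hahnNorm q n a b (n + r) := by
  have hAB := rpow_add_one_mul_rpow_add_one_lt_one hq0 hq1 ha hb
  have hpow_lt (k : ℕ) : q ^ (a + 1) * q ^ (b + 1) * q ^ k < 1 :=
    sub_pos.1 (one_sub_mul_pow_pos hq0 hq1 hAB k)
  have hfirst := qPoch_mul_pow_div_pos hq0 hq1 hAB n
  have hmid := qPoch_pos hq0 hq1 (hpow_lt (2 * n)) r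
  have hr := qPoch_pos hq0 hq1 hq1 r
  have hn := qPoch_pos hq0 hq1 hq1 n
  have hA := qPoch_pos hq0 hq1 (rpow_add_one_lt_one hq0 hq1 ha) n
  have hB := qPoch_pos hq0 hq1 (rpow_add_one_lt_one hq0 hq1 hb) n
  rw [hahnNorm_add hq0 hq1 (by linarith) hab]
  positivity

theorem hahnNorm_succ (hq0 : 0 < q) (hq1 : q < 1) (hab : -1 < a + b + 1) (hab0 : a + b + 1 ≠ 0)
    (n r : ℕ) :
    hahnNorm q n a b (n + r + 1) * (1 - q ^ (r + 1)) * q ^ (2 * n)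
      = hahnNorm q n a b (n + r) * (1 - q ^ (a + 1) * q ^ (b + 1) * q ^ (2 * n + r)) := by
  have hr := one_sub_pow_succ_ne_zero hq0 hq1 r
  have hr' := qPoch_self_ne_zero hq0 hq1 r
  have := hq0.ne'
  rw [add_assoc n r, hahnNorm_add hq0 hq1 hab hab0, hahnNorm_add hq0 hq1 hab hab0, qPoch_succ,
    qPoch_succ q, ← pow_succ' q, mul_add_one (2 * n), pow_add q (2 * n * r), pow_add q (2 * n) r]
  field_simp

end HahnNorm

section HahnFun

variable {q a b : ℝ}

theorem sqrt_sigma_succ_mul_sqrt (hq0 : 0 < q) (hq1 : q < 1) (ha : -1 < a) {u v : ℝ} (n : ℕ)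
    (h : v * (1 - q ^ (n + 1)) = u * (1 - q ^ (a + 1) * q ^ n)) :
    √(sigma q a (n + 1)) * √u = ladderScale q * (1 - q ^ (n + 1)) * √v := by
  have hA := one_sub_mul_pow_pos hq0 hq1 (rpow_add_one_lt_one hq0 hq1 ha) n
  rw [sqrt_sigma_succ hq0 hq1, mul_assoc, mul_assoc,
    sqrt_mul_sqrt_of_mul_eq_mul (one_sub_pow_nonneg hq0 hq1 _) hA.le h]

theorem sqrt_sigma_succ_mul_sqrt' (hq0 : 0 < q) (hq1 : q < 1) (ha : -1 < a) {u v : ℝ} (n : ℕ)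
    (h : v * (1 - q ^ (n + 1)) = u * (1 - q ^ (a + 1) * q ^ n)) :
    √(sigma q a (n + 1)) * √v = ladderScale q * (1 - q ^ (a + 1) * q ^ n) * √u := by
  have hA := one_sub_mul_pow_pos hq0 hq1 (rpow_add_one_lt_one hq0 hq1 ha) n
  rw [sqrt_sigma_succ hq0 hq1, mul_assoc, mul_assoc, mul_comm (1 - q ^ (n + 1)),
    sqrt_mul_sqrt_of_mul_eq_mul hA.le (one_sub_pow_nonneg hq0 hq1 _) h.symm]

theorem hahnFun_eq_zero {n : ℕ} {x N : ℤ} (h : x < 0 ∨ N < x ∨ N < n) :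
    hahnFun q n x a b N = 0 :=
  if_neg (by omega)

theorem hahnFun_natCast (hq0 : 0 < q) (hq1 : q < 1) (ha : -1 < a) (hb : -1 < b) {n x N : ℕ}
    (hx : x ≤ N) (hn : n ≤ N) :
    hahnFun q n x a b N = √(hahnWeight q x a b N) / √(hahnNorm q n a b N) *
      hahnPoly q (q ^ (a + 1)) (q ^ (b + 1)) n (q ^ x)⁻¹ (q ^ N)⁻¹ := by
  rw [hahnFun, if_pos ⟨by positivity, by exact_mod_cast hx, by exact_mod_cast hn⟩,
    Int.toNat_natCast, Int.toNat_natCast, hahn_eq_hahnPoly hq0 hq1 ha hn,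
    Real.sqrt_div (hahnWeight_pos hq0 hq1 ha hb x N).le]

theorem rpow_weight (hq0 : 0 < q) (a : ℝ) (n : ℕ) :
    q ^ weight a n = q ^ n * √(q ^ (a + 1)) := by
  rw [weight, Real.rpow_add hq0, Real.rpow_natCast, Real.sqrt_eq_rpow, ← Real.rpow_mul hq0.le]
  congr 2
  ring

theorem sqrt_sigma_mul_hahnFun_sub_one (hq0 : 0 < q) (hq1 : q < 1) (ha : -1 < a) (hb : -1 < b)
    {n x N : ℕ} (hx : x ≤ N + 1) (hn : n ≤ N) :
    √(sigma q a x) * hahnFun q n (x - 1) a b N =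
      ladderScale q * √(hahnWeight q x a b (N + 1)) / √(hahnNorm q n a b N) * ((1 - q ^ x) *
        hahnPoly q (q ^ (a + 1)) (q ^ (b + 1)) n ((q ^ x)⁻¹ * q) (q ^ N)⁻¹) := by
  cases x with
  | zero => simp [sigma_zero]
  | succ x =>
    obtain ⟨y, rfl⟩ := Nat.exists_eq_add_of_le (Nat.le_of_succ_le_succ hx)
    have hX : (q ^ (x + 1))⁻¹ * q = (q ^ x)⁻¹ := by
      have := hq0.ne'
      rw [pow_succ]
      field_simp
    have hsqrt := sqrt_sigma_succ_mul_sqrt hq0 hq1 ha x (hahnWeight_succ_left hq0 hq1 a b x y)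
    rw [Nat.cast_succ, add_sub_cancel_right, hahnFun_natCast hq0 hq1 ha hb (by omega) hn, hX,
      add_right_comm x y 1]
    linear_combination (√(hahnNorm q n a b (x + y)))⁻¹ *
      hahnPoly q (q ^ (a + 1)) (q ^ (b + 1)) n (q ^ x)⁻¹ (q ^ (x + y))⁻¹ * hsqrt

theorem rpow_weight_mul_sqrt_sigma_mul_hahnFun (hq0 : 0 < q) (hq1 : q < 1) (ha : -1 < a)
    (hb : -1 < b) {n x y N : ℕ} (hN : x + y = N + 1) (hn : n ≤ N) :
    q ^ weight a x * √(sigma q b y) * hahnFun q n x a b N =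
      ladderScale q * √(hahnWeight q x a b (N + 1)) / √(hahnNorm q n a b N) *
        (q ^ x * (1 - q ^ y) *
          hahnPoly q (q ^ (a + 1)) (q ^ (b + 1)) n (q ^ x)⁻¹ (q ^ N)⁻¹) := by
  cases y with
  | zero => simp [sigma_zero]
  | succ y =>
    obtain rfl : x + y = N := by omega
    have hsqrt := sqrt_sigma_succ_mul_sqrt hq0 hq1 hb y (hahnWeight_succ_right hq0 hq1 a b x y)
    rw [Real.sqrt_mul (Real.rpow_nonneg hq0.le _)] at hsqrt
    rw [rpow_weight hq0, hahnFun_natCast hq0 hq1 ha hb (by omega) hn, ← hN]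
    linear_combination q ^ x * (√(hahnNorm q n a b (x + y)))⁻¹ *
      hahnPoly q (q ^ (a + 1)) (q ^ (b + 1)) n (q ^ x)⁻¹ (q ^ (x + y))⁻¹ * hsqrt

theorem rpow_two_mul_add_add_one (hq0 : 0 < q) (a b : ℝ) (n : ℕ) :
    q ^ (2 * n + a + b + 1 + 1) = q ^ (a + 1) * q ^ (b + 1) * q ^ (2 * n) := by
  rw [← Real.rpow_natCast, ← Real.rpow_add hq0, ← Real.rpow_add hq0]
  congr 1
  push_cast
  ring

theorem hahnNorm_succ' (hq0 : 0 < q) (hq1 : q < 1) (hab : -1 < a + b + 1) (hab0 : a + b + 1 ≠ 0)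
    (n r : ℕ) :
    (q ^ n) ^ 2 * hahnNorm q n a b (n + r + 1) * (1 - q ^ (r + 1))
      = hahnNorm q n a b (n + r) * (1 - q ^ (2 * n + a + b + 1 + 1) * q ^ r) := by
  rw [rpow_two_mul_add_add_one hq0]
  linear_combination hahnNorm_succ hq0 hq1 hab hab0 n r

theorem sqrt_sigma_mul_sqrt_hahnNorm (hq0 : 0 < q) (hq1 : q < 1) (hab : -1 < a + b + 1)
    (hab0 : a + b + 1 ≠ 0) (n r : ℕ) :
    √(sigma q (2 * n + a + b + 1) (r + 1)) * √(hahnNorm q n a b (n + r))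
      = ladderScale q * (1 - q ^ (r + 1)) * (q ^ n * √(hahnNorm q n a b (n + r + 1))) := by
  have := n.cast_nonneg (α := ℝ)
  rw [sqrt_sigma_succ_mul_sqrt hq0 hq1 (by linarith) r (hahnNorm_succ' hq0 hq1 hab hab0 n r),
    Real.sqrt_mul (sq_nonneg _), Real.sqrt_sq (by positivity)]

theorem sqrt_sigma_mul_sqrt_hahnNorm_succ (hq0 : 0 < q) (hq1 : q < 1) (hab : -1 < a + b + 1)
    (hab0 : a + b + 1 ≠ 0) (n r : ℕ) :
    √(sigma q (2 * n + a + b + 1) (r + 1)) * (q ^ n * √(hahnNorm q n a b (n + r + 1)))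
      = ladderScale q * (1 - q ^ (a + 1) * q ^ (b + 1) * q ^ (2 * n) * q ^ r)
          * √(hahnNorm q n a b (n + r)) := by
  have := n.cast_nonneg (α := ℝ)
  rw [← rpow_two_mul_add_add_one hq0,
    ← sqrt_sigma_succ_mul_sqrt' hq0 hq1 (by linarith) r (hahnNorm_succ' hq0 hq1 hab hab0 n r),
    Real.sqrt_mul (sq_nonneg _), Real.sqrt_sq (by positivity)]

theorem hahnFun_raising (hq0 : 0 < q) (hq1 : q < 1) (ha : -1 < a) (hb : -1 < b)
    (hab : a + b + 1 ≠ 0) {n x y r : ℕ} (h : x + y = n + r + 1) :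
    √(sigma q a x) * hahnFun q n (x - 1) a b (n + r : ℕ)
        + q ^ weight a x * √(sigma q b y) * hahnFun q n x a b (n + r : ℕ)
      = √(sigma q (2 * n + a + b + 1) (r + 1)) * hahnFun q n x a b (n + r + 1 : ℕ) := by
  have hN := (Real.sqrt_pos.2 (hahnNorm_pos hq0 hq1 ha hb hab n r)).ne'
  have hN' := (Real.sqrt_pos.2 (hahnNorm_pos hq0 hq1 ha hb hab n (r + 1))).ne'
  have hsqrt := sqrt_sigma_mul_sqrt_hahnNorm hq0 hq1 (by linarith) hab n r
  rw [← add_assoc] at hN'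
  rw [sqrt_sigma_mul_hahnFun_sub_one hq0 hq1 ha hb (by omega) (Nat.le_add_right n r),
    rpow_weight_mul_sqrt_sigma_mul_hahnFun hq0 hq1 ha hb h (Nat.le_add_right n r), ← mul_add,
    hahnPoly_raising_pow hq0.ne' _ _ h, hahnFun_natCast hq0 hq1 ha hb (by omega) (by omega)]
  generalize hahnPoly q _ _ n _ _ = P
  field_simp
  linear_combination -(√(hahnWeight q x a b (n + r + 1)) * P) * hsqrt

theorem sqrt_sigma_mul_hahnFun_add_one (hq0 : 0 < q) (hq1 : q < 1) (ha : -1 < a) (hb : -1 < b)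
    {n x y : ℕ} (hn : n ≤ x + y + 1) :
    √(sigma q a (x + 1)) * hahnFun q n (x + 1) a b (x + y + 1 : ℕ) =
      ladderScale q * √(hahnWeight q x a b (x + y)) / √(hahnNorm q n a b (x + y + 1)) *
        ((1 - q ^ (a + 1) * q ^ x) * hahnPoly q (q ^ (a + 1)) (q ^ (b + 1)) n
          (q ^ (x + 1))⁻¹ (q ^ (x + y + 1))⁻¹) := by
  have hsqrt := sqrt_sigma_succ_mul_sqrt' hq0 hq1 ha x (hahnWeight_succ_left hq0 hq1 a b x y)
  rw [← Nat.cast_succ x, hahnFun_natCast hq0 hq1 ha hb (by omega) hn, Nat.succ_eq_add_one]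
  rw [add_right_comm x 1 y] at hsqrt
  linear_combination (√(hahnNorm q n a b (x + y + 1)))⁻¹ *
    hahnPoly q (q ^ (a + 1)) (q ^ (b + 1)) n (q ^ (x + 1))⁻¹ (q ^ (x + y + 1))⁻¹ * hsqrt

theorem rpow_weight_mul_sqrt_sigma_succ_mul_hahnFun (hq0 : 0 < q) (hq1 : q < 1) (ha : -1 < a)
    (hb : -1 < b) {n x y : ℕ} (hn : n ≤ x + y + 1) :
    q ^ weight a x * √(sigma q b (y + 1)) * hahnFun q n x a b (x + y + 1 : ℕ) =
      ladderScale q * √(hahnWeight q x a b (x + y)) / √(hahnNorm q n a b (x + y + 1)) *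
        (q ^ x * q ^ (a + 1) * (1 - q ^ (b + 1) * q ^ y) *
          hahnPoly q (q ^ (a + 1)) (q ^ (b + 1)) n (q ^ x)⁻¹ (q ^ (x + y + 1))⁻¹) := by
  have hA := Real.rpow_nonneg hq0.le (a + 1)
  have hsqrt := sqrt_sigma_succ_mul_sqrt' hq0 hq1 hb y (hahnWeight_succ_right hq0 hq1 a b x y)
  rw [Real.sqrt_mul hA, ← add_assoc] at hsqrt
  rw [rpow_weight hq0, hahnFun_natCast hq0 hq1 ha hb (by omega) hn]
  generalize hahnPoly q _ _ n _ _ = P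
  linear_combination (√(hahnNorm q n a b (x + y + 1)))⁻¹ * q ^ x * √(q ^ (a + 1)) * P * hsqrt
    + (√(hahnNorm q n a b (x + y + 1)))⁻¹ * q ^ x * P * ladderScale q * (1 - q ^ (b + 1) * q ^ y) *
      √(hahnWeight q x a b (x + y)) * Real.mul_self_sqrt hA

theorem hahnFun_lowering (hq0 : 0 < q) (hq1 : q < 1) (ha : -1 < a) (hb : -1 < b)
    (hab : a + b + 1 ≠ 0) {n x y r : ℕ} (h : x + y + 1 = n + r) :
    √(sigma q a (x + 1)) * hahnFun q n (x + 1) a b (x + y + 1 : ℕ)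
        + q ^ weight a x * √(sigma q b (y + 1)) * hahnFun q n x a b (x + y + 1 : ℕ)
      = √(sigma q (2 * n + a + b + 1) r) * hahnFun q n x a b (x + y : ℕ) := by
  have hrec := hahnPoly_lowering_pow hq0 hq1 (q ^ (a + 1)) (q ^ (b + 1)) n x y
  rw [sqrt_sigma_mul_hahnFun_add_one hq0 hq1 ha hb (by omega),
    rpow_weight_mul_sqrt_sigma_succ_mul_hahnFun hq0 hq1 ha hb (by omega), ← mul_add]
  cases r with
  | zero =>
    obtain rfl : n = x + y + 1 := h.symm
    rw [hahnPoly_eq_zero hq0.ne', mul_zero, mul_eq_zero] at hrec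
    rw [hrec.resolve_left (by positivity), mul_zero, sigma_zero, Real.sqrt_zero, zero_mul]
  | succ r =>
    obtain h' : x + y = n + r := by omega
    have hN := (Real.sqrt_pos.2 (hahnNorm_pos hq0 hq1 ha hb hab n r)).ne'
    have hN' := (Real.sqrt_pos.2 (hahnNorm_pos hq0 hq1 ha hb hab n (r + 1))).ne'
    have hsqrt := sqrt_sigma_mul_sqrt_hahnNorm_succ hq0 hq1 (by linarith) hab n r
    rw [← add_assoc] at hN'
    rw [hahnFun_natCast hq0 hq1 ha hb (by omega) (by omega), h']
    rw [h'] at hrec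
    generalize hahnPoly q _ _ n (q ^ x)⁻¹ (q ^ (n + r))⁻¹ = P at *
    generalize _ + _ * hahnPoly q _ _ n _ _ = R at *
    field_simp
    refine mul_left_cancel₀ (pow_ne_zero n hq0.ne') ?_
    linear_combination √(hahnWeight q x a b (n + r)) *
      (ladderScale q * √(hahnNorm q n a b (n + r)) * hrec - P * hsqrt)

-- The case `e = 0` is the raising relation, the case `e = 1` the lowering relation.
theorem hahnFun_ladder (hq0 : 0 < q) (hq1 : q < 1) (ha : -1 < a) (hb : -1 < b)
    (hab : a + b + 1 ≠ 0) {e : ℕ} (he : e ≤ 1) (n x y : ℕ) :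
    √(sigma q a (x + e)) * hahnFun q n (x + 2 * e - 1) a b (x + y + 2 * e - 1)
        + q ^ weight a x * √(sigma q b (y + e)) * hahnFun q n x a b (x + y + 2 * e - 1)
      = √(sigma q (2 * n + a + b + 1) (x + y - n + e)) * hahnFun q n x a b (x + y) := by
  obtain hn | ⟨r, hr⟩ : x + y + e < n ∨ ∃ r, x + y + e = n + r :=
    (lt_or_ge _ _).imp_right Nat.exists_eq_add_of_le
  · rw [hahnFun_eq_zero (by omega), hahnFun_eq_zero (by omega), hahnFun_eq_zero (by omega)]
    simp only [mul_zero, add_zero]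
  obtain rfl | rfl := Nat.le_one_iff_eq_zero_or_eq_one.1 he
  · cases r with
    | zero =>
      rw [hahnFun_eq_zero (by omega), hahnFun_eq_zero (by omega), show x + y - n + 0 = 0 by omega,
        sigma_zero, Real.sqrt_zero, mul_zero, mul_zero, zero_mul, add_zero]
    | succ r =>
      have h := hahnFun_raising hq0 hq1 ha hb hab (n := n) (x := x) (y := y) (r := r) hr
      rw [show x + y - n + 0 = r + 1 by omega, show (x : ℤ) + y = (n + r + 1 : ℕ) by omega,
        show (x : ℤ) + 2 * (0 : ℕ) - 1 = x - 1 by omega,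
        show ((n + r + 1 : ℕ) : ℤ) + 2 * (0 : ℕ) - 1 = (n + r : ℕ) by omega]
      exact h
  · have h := hahnFun_lowering hq0 hq1 ha hb hab (n := n) (x := x) (y := y) (r := r) hr
    rw [show (x : ℤ) + 2 * (1 : ℕ) - 1 = x + 1 by omega,
      show (x : ℤ) + y + 2 * (1 : ℕ) - 1 = (x + y + 1 : ℕ) by omega, h]
    cases r with
    | zero => rw [hahnFun_eq_zero (by omega), hahnFun_eq_zero (by omega), mul_zero, mul_zero]
    | succ r => rw [show x + y - n + 1 = r + 1 by omega, Nat.cast_add]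

theorem hahnFun_self_sq (hq0 : 0 < q) (hq1 : q < 1) (ha : -1 < a) (hb : -1 < b)
    (hab : a + b + 1 ≠ 0) (x y : ℕ) :
    hahnFun q (x + y) x a b (x + y : ℕ) ^ 2 *
        qPoch (q ^ (a + 1) * q ^ (b + 1) * q ^ (x + y) / q) q (x + y)
      = qPoch q q (x + y) * (vandermondeTerm q (q ^ (a + 1)) (q ^ (b + 1)) x y /
          (qPoch q q x * qPoch q q y)) := by
  have hpow : (q ^ x.choose 2) ^ 2 = q ^ (x * (x - 1)) := by
    rw [← pow_mul, Nat.choose_two_right, Nat.div_mul_cancel (Nat.even_mul_pred_self x).two_dvd]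
  have hω := (hahnWeight_pos hq0 hq1 ha hb x (x + y)).le
  have hη := hahnNorm_pos hq0 hq1 ha hb hab (x + y) 0
  have hη' := hahnNorm_add hq0 hq1 (by linarith) hab (x + y) 0
  have hn := qPoch_inv_pow_self_sq hq0.ne' (x + y)
  have hA := rpow_add_one_lt_one hq0 hq1 ha
  have hAxy := qPoch_add (q ^ (a + 1)) q x y
  have hBxy := qPoch_add (q ^ (b + 1)) q y x
  have hx := qPoch_self_ne_zero hq0 hq1 x
  have hy := qPoch_self_ne_zero hq0 hq1 y
  rw [add_zero, qPoch_zero, qPoch_zero, mul_one, div_one, mul_zero, pow_zero, mul_one] at hη'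
  rw [add_zero] at hη
  rw [hahnFun_natCast hq0 hq1 ha hb (by omega) le_rfl, mul_pow, div_pow, Real.sq_sqrt hω,
    Real.sq_sqrt hη.le, hahnWeight_add hq0.le, vandermondeTerm, hahnPoly_self hq0 hq1 hA,
    div_mul_eq_mul_div, div_mul_eq_mul_div, div_eq_iff hη.ne', hη']
  generalize qPoch (q ^ (a + 1) * q ^ (b + 1) * q ^ (x + y) / q) q (x + y) = D
  have : q ^ ((x + y) * (x + y + 1)) ≠ 0 := pow_ne_zero _ hq0.ne'
  rw [add_comm y x] at hBxy
  rw [hAxy, hBxy]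
  generalize qPoch (q ^ (x + y))⁻¹ q (x + y) = H at *
  generalize qPoch q q (x + y) = P at *
  field_simp
  rw [hpow, ← hn, ← pow_mul, mul_comm x 2, pow_mul, neg_sq]
  ring

theorem sum_hahnFun_self_sq (hq0 : 0 < q) (hq1 : q < 1) (ha : -1 < a) (hb : -1 < b)
    (hab : a + b + 1 ≠ 0) (n : ℕ) :
    ∑ p ∈ antidiagonal n, hahnFun q n p.1 a b n ^ 2 = 1 := by
  have hD : qPoch (q ^ (a + 1) * q ^ (b + 1) * q ^ n / q) q n ≠ 0 :=
    (qPoch_mul_pow_div_pos hq0 hq1 (rpow_add_one_mul_rpow_add_one_lt_one hq0 hq1 ha hb) n).ne'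
  have hterm : ∀ p ∈ antidiagonal n, hahnFun q n p.1 a b n ^ 2 *
        qPoch (q ^ (a + 1) * q ^ (b + 1) * q ^ n / q) q n
      = qPoch q q n * (vandermondeTerm q (q ^ (a + 1)) (q ^ (b + 1)) p.1 p.2 /
          (qPoch q q p.1 * qPoch q q p.2)) := by
    rintro ⟨x, y⟩ hp
    obtain rfl := mem_antidiagonal.1 hp
    exact hahnFun_self_sq hq0 hq1 ha hb hab x y
  refine mul_right_cancel₀ hD ?_
  rw [Finset.sum_mul, Finset.sum_congr rfl hterm, ← Finset.mul_sum,
    sum_antidiagonal_vandermondeTerm hq0 hq1, mul_div_cancel₀ _ (qPoch_self_ne_zero hq0 hq1 n),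
    one_mul]

theorem sum_hahnFun_ladder (hq0 : 0 < q) (hq1 : q < 1) (ha : -1 < a) (hb : -1 < b)
    (hab : a + b + 1 ≠ 0) (n m N : ℕ) :
    √(sigma q (2 * n + a + b + 1) (N + 1 - n)) *
        ∑ p ∈ antidiagonal (N + 1), hahnFun q n p.1 a b (N + 1) * hahnFun q m p.1 a b (N + 1)
      = √(sigma q (2 * m + a + b + 1) (N - m + 1)) *
        ∑ p ∈ antidiagonal N, hahnFun q n p.1 a b N * hahnFun q m p.1 a b N := by
  have hraise : ∀ p ∈ antidiagonal (N + 1), √(sigma q (2 * n + a + b + 1) (N + 1 - n)) *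
        (hahnFun q n p.1 a b (N + 1) * hahnFun q m p.1 a b (N + 1))
      = √(sigma q a p.1) * hahnFun q n (p.1 - 1) a b N * hahnFun q m p.1 a b (N + 1)
        + q ^ weight a p.1 * √(sigma q b p.2) * hahnFun q n p.1 a b N *
          hahnFun q m p.1 a b (N + 1) := by
    intro p hp
    have h := hahnFun_ladder hq0 hq1 ha hb hab zero_le_one n p.1 p.2
    have hN := mem_antidiagonal.1 hp
    have hN' : (p.1 + p.2 : ℤ) = N + 1 := by omega
    simp only [hN, hN', Nat.cast_zero, mul_zero, add_zero, add_sub_cancel_right] at h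
    rw [← mul_assoc, ← h, add_mul]
  rw [Finset.mul_sum, Finset.sum_congr rfl hraise, Finset.sum_add_distrib,
    Finset.Nat.sum_antidiagonal_succ, Finset.Nat.sum_antidiagonal_succ', Finset.mul_sum]
  simp only [sigma_zero, Real.sqrt_zero, zero_mul, mul_zero, zero_add,
    ← Finset.sum_add_distrib]
  refine Finset.sum_congr rfl fun p hp => ?_
  have h := hahnFun_ladder hq0 hq1 ha hb hab le_rfl m p.1 p.2
  have hN := mem_antidiagonal.1 hp
  have hN' : (p.1 + p.2 : ℤ) = N := by omega
  simp only [hN, hN', Nat.cast_one, mul_one] at h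
  rw [show (p.1 + 2 - 1 : ℤ) = p.1 + 1 by ring, show (N + 2 - 1 : ℤ) = N + 1 by ring] at h
  rw [Nat.cast_succ, add_sub_cancel_right]
  linear_combination hahnFun q n p.1 a b N * h

theorem sum_hahnFun_mul (hq0 : 0 < q) (hq1 : q < 1) (ha : -1 < a) (hb : -1 < b)
    (hab : a + b + 1 ≠ 0) {n m N : ℕ} (hn : n ≤ N) (hm : m ≤ N) :
    ∑ p ∈ antidiagonal N, hahnFun q n p.1 a b N * hahnFun q m p.1 a b N =
      if n = m then 1 else 0 := by
  wlog hnm : n ≤ m generalizing n m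
  · simpa only [mul_comm, eq_comm] using this hm hn (le_of_not_ge hnm)
  obtain ⟨r, rfl⟩ := Nat.exists_eq_add_of_le hn
  induction r with
  | zero =>
    obtain rfl : n = m := by omega
    simpa only [sq, if_true, add_zero] using sum_hahnFun_self_sq hq0 hq1 ha hb hab n
  | succ r ih =>
    have hσ : √(sigma q (2 * n + a + b + 1) (r + 1)) ≠ 0 :=
      (Real.sqrt_pos.2 (sigma_succ_pos hq0 hq1 (by linarith [n.cast_nonneg (α := ℝ)]) r)).ne'
    have h := sum_hahnFun_ladder hq0 hq1 ha hb hab n m (n + r)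
    rw [show n + r + 1 - n = r + 1 by omega, ← Nat.cast_succ (n + r)] at h
    refine mul_left_cancel₀ hσ (h.trans ?_)
    obtain rfl | hm : m = n + r + 1 ∨ m ≤ n + r := by omega
    · rw [if_neg (by omega), mul_zero]
      refine mul_eq_zero_of_right _ (Finset.sum_eq_zero fun p _ => ?_)
      rw [hahnFun_eq_zero (n := n + r + 1) (by omega), mul_zero]
    · rw [ih (by omega) hm]
      split_ifs with hnm'
      · rw [← hnm', Nat.add_sub_cancel_left]
      · rw [mul_zero, mul_zero]

end HahnFun

section PartialSums

variable {d : ℕ}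

theorem mem_initialSet {k : ℕ} {i : Fin d} : i ∈ initialSet d k ↔ i.val < k := by
  simp [initialSet]

theorem initialSet_self (d : ℕ) : initialSet d d = Finset.univ := by
  ext i
  simp [mem_initialSet]

theorem initialSet_succ {k : ℕ} (hk : k < d) :
    initialSet d (k + 1) = Finset.cons ⟨k, hk⟩ (initialSet d k) (by simp [mem_initialSet]) := by
  ext i
  simp only [mem_initialSet, Finset.mem_cons, Fin.ext_iff]
  omega

theorem psum_eq_sum {M : Type*} [AddCommMonoid M] (v : Fin d → M) (k : ℕ) :
    psum v k = ∑ i ∈ initialSet d k, v i := rfl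

theorem psum_zero {M : Type*} [AddCommMonoid M] (v : Fin d → M) : psum v 0 = 0 := by
  simp [psum]

theorem psum_succ {M : Type*} [AddCommMonoid M] (v : Fin d → M) {k : ℕ} (hk : k < d) :
    psum v (k + 1) = psum v k + v ⟨k, hk⟩ := by
  rw [psum_eq_sum, psum_eq_sum, initialSet_succ hk, Finset.sum_cons, add_comm]

theorem psum_self {M : Type*} [AddCommMonoid M] (v : Fin d → M) : psum v d = ∑ i, v i := by
  rw [psum_eq_sum, initialSet_self]

theorem psum_weight (α : Fin d → ℝ) (y : Fin d → ℕ) {k : ℕ} (hk : k ≤ d) :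
    psum (fun l => weight (α l) (y l)) k = (psum y k : ℕ) + (psum α k + k) / 2 := by
  induction k with
  | zero => simp [psum_zero]
  | succ k ih =>
    rw [psum_succ _ hk, psum_succ _ hk, psum_succ _ hk, ih (by omega), weight]
    push_cast
    ring

theorem neg_natCast_le_psum {α : Fin d → ℝ} (hα : ∀ i, -1 < α i) {k : ℕ} (hk : k ≤ d) :
    -(k : ℝ) ≤ psum α k := by
  induction k with
  | zero => simp [psum_zero]
  | succ k ih =>
    rw [psum_succ _ hk, Nat.cast_succ]
    linarith [hα ⟨k, hk⟩, ih (by omega)]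

theorem psum_update_of_le {M : Type*} [AddCommMonoid M] (v : Fin d → M) {i : Fin d} {k : ℕ}
    (h : k ≤ i) (c : M) : psum (Function.update v i c) k = psum v k := by
  rw [psum_eq_sum, psum_eq_sum, Finset.sum_update_of_notMem]
  simpa [mem_initialSet] using h

theorem psum_update_add {M : Type*} [AddCommMonoid M] (v : Fin d → M) {i : Fin d} {k : ℕ}
    (h : i < k) (c : M) : psum (Function.update v i c) k + v i = psum v k + c := by
  have hi : i ∈ initialSet d k := mem_initialSet.2 h
  rw [psum_eq_sum, psum_eq_sum, Finset.sum_update_of_mem hi, Finset.sdiff_singleton_eq_erase,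
    add_assoc, Finset.sum_erase_add _ _ hi, add_comm]

/-- The tuple `y` with its entry `y_i` raised by one (`e = 1`) or lowered by one (`e = 0`). The
case `e = 0` is only used for `y_i ≠ 0`. -/
def stepAt {d : ℕ} (e : ℕ) (i : Fin d) (y : Fin d → ℕ) : Fin d → ℕ :=
  Function.update y i (y i + 2 * e - 1)

theorem psum_stepAt_of_lt {e : ℕ} {y : Fin d → ℕ} {i : Fin d} {k : ℕ} (h : i < k)
    (hy : y i + e ≠ 0) : ((psum (stepAt e i y) k : ℕ) : ℤ) = (psum y k : ℕ) + 2 * e - 1 := by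
  have := psum_update_add y h (y i + 2 * e - 1)
  unfold stepAt
  omega

end PartialSums

section PartialPsi

variable {d : ℕ}

/-- The parameter `2 N_j + A_{j+1} + j` of the irreducible constituent of the first `j + 1` factors
that contains the vectors with coupled labels `n`. -/
noncomputable def coupledParam (α : Fin d → ℝ) (n : Fin d → ℕ) (j : ℕ) : ℝ :=
  2 * ((psum n j : ℕ) : ℝ) + psum α (j + 1) + j

/-- The factor with index `j` of the product defining `Psi`. -/
noncomputable def psiFactor (q : ℝ) (α : Fin d → ℝ) (n y : Fin d → ℕ) (j : Fin (d - 1)) : ℝ :=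
  hahnFun q (n ⟨j, by omega⟩) (((psum y (j + 1) : ℕ) : ℤ) - ((psum n j : ℕ) : ℤ))
    (coupledParam α n j) (α ⟨j + 1, by omega⟩)
    (((psum y (j + 2) : ℕ) : ℤ) - ((psum n j : ℕ) : ℤ))

/-- The product of the factors of `Psi` that come from coupling the first `k` tensor factors. -/
noncomputable def partialPsi (q : ℝ) (α : Fin d → ℝ) (n y : Fin d → ℕ) (k : ℕ) : ℝ :=
  ∏ j : Fin (d - 1) with j.val + 1 < k, psiFactor q α n y j

/-- The cofactor of `partialPsi` in `Psi`: it depends on `y` only through the partial sums over at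
least `k` entries. -/
noncomputable def tailPsi (q : ℝ) (α : Fin d → ℝ) (n y : Fin d → ℕ) (k : ℕ) : ℝ :=
  (if psum n d = psum y d then 1 else 0) *
    ∏ j : Fin (d - 1) with ¬ j.val + 1 < k, psiFactor q α n y j

/-- The parameters for which all constituents are unitary positive-discrete series and no
normalization `η` of the couplings degenerates to `0 / 0`. -/
structure Admissible (α : Fin d → ℝ) : Prop where
  neg_one_lt : ∀ i, -1 < α i
  psum_add_ne_one : ∀ k ∈ Finset.Icc 2 d, psum α k + k ≠ 1

theorem Admissible.of_pos {α : Fin d → ℝ} (hα : ∀ i, 0 < α i) : Admissible α where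
  neg_one_lt i := neg_one_lt_zero.trans (hα i)
  psum_add_ne_one k hk := by
    have hsum : 0 ≤ psum α k := Finset.sum_nonneg fun i _ => (hα i).le
    have htwo : (2 : ℝ) ≤ k := by exact_mod_cast (Finset.mem_Icc.1 hk).1
    linarith

theorem neg_one_lt_coupledParam {α : Fin d → ℝ} (hα : ∀ i, -1 < α i) (n : Fin d → ℕ) {j : ℕ}
    (hj : j < d) : -1 < coupledParam α n j := by
  have := (psum n j).cast_nonneg (α := ℝ)
  rw [coupledParam, psum_succ α hj]
  linarith [hα ⟨j, hj⟩, neg_natCast_le_psum hα hj.le]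

theorem coupledParam_succ (α : Fin d → ℝ) (n : Fin d → ℕ) {j : ℕ} (hj : j + 1 < d) :
    coupledParam α n (j + 1) =
      2 * (n ⟨j, by omega⟩ : ℝ) + coupledParam α n j + α ⟨j + 1, hj⟩ + 1 := by
  rw [coupledParam, coupledParam, psum_succ n (show j < d by omega), psum_succ α hj]
  push_cast
  ring

theorem Admissible.coupledParam_add_ne_zero {α : Fin d → ℝ} (hα : Admissible α) (n : Fin d → ℕ)
    {j : ℕ} (hj : j + 1 < d) : coupledParam α n j + α ⟨j + 1, hj⟩ + 1 ≠ 0 := by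
  have hne := hα.psum_add_ne_one (j + 2) (Finset.mem_Icc.2 ⟨by omega, hj⟩)
  have hle := neg_natCast_le_psum hα.neg_one_lt hj
  rw [psum_succ α hj] at hne hle
  push_cast at hne hle
  rw [coupledParam]
  obtain h0 | hpos := (psum n j).eq_zero_or_pos
  · rw [h0, Nat.cast_zero]
    contrapose! hne
    linarith
  · have : (1 : ℝ) ≤ (psum n j : ℕ) := by exact_mod_cast hpos
    linarith

variable (q : ℝ) (α : Fin d → ℝ)

theorem Psi_eq_partialPsi_mul_tailPsi (n y : Fin d → ℕ) (k : ℕ) :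
    Psi q α n y = partialPsi q α n y k * tailPsi q α n y k := by
  rw [partialPsi, tailPsi, mul_left_comm, Finset.prod_filter_mul_prod_filter_not]
  rfl

theorem Psi_eq_partialPsi (n y : Fin d → ℕ) :
    Psi q α n y = if psum n d = psum y d then partialPsi q α n y d else 0 := by
  have hempty : ({j : Fin (d - 1) | ¬ j.val + 1 < d} : Finset _) = ∅ :=
    Finset.filter_false_of_mem (by omega)
  rw [Psi_eq_partialPsi_mul_tailPsi q α n y d, tailPsi, hempty, Finset.prod_empty, mul_one,
    mul_ite, mul_one, mul_zero]

theorem partialPsi_one (n y : Fin d → ℕ) : partialPsi q α n y 1 = 1 := by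
  rw [partialPsi, Finset.filter_false_of_mem (by omega), Finset.prod_empty]

theorem partialPsi_succ (n y : Fin d → ℕ) {j : ℕ} (hj : j < d - 1) :
    partialPsi q α n y (j + 2) = partialPsi q α n y (j + 1) * psiFactor q α n y ⟨j, hj⟩ := by
  have : ({i : Fin (d - 1) | i.val + 1 < j + 2} : Finset _) =
      Finset.cons ⟨j, hj⟩ ({i : Fin (d - 1) | i.val + 1 < j + 1} : Finset _) (by simp) := by
    ext i
    simp only [Finset.mem_filter, Finset.mem_univ, true_and, Finset.mem_cons, Fin.ext_iff]
    omega
  rw [partialPsi, this, Finset.prod_cons, mul_comm]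
  rfl

variable {q α}

theorem partialPsi_congr {n n' y y' : Fin d → ℕ} {k : ℕ} (hn : ∀ i : Fin d, i + 1 < k → n i = n' i)
    (hy : ∀ m ≤ k, psum y m = psum y' m) : partialPsi q α n y k = partialPsi q α n' y' k := by
  refine Finset.prod_congr rfl fun j hj => ?_
  have hj := (Finset.mem_filter.1 hj).2
  have hpsum : psum n j = psum n' j :=
    Finset.sum_congr rfl fun i hi => hn i (by have := (Finset.mem_filter.1 hi).2; omega)
  rw [psiFactor, psiFactor, coupledParam, coupledParam, hy _ (by omega), hy _ (by omega), hpsum,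
    hn _ (by simpa using hj)]

theorem partialPsi_update_last (n y : Fin d → ℕ) {j : ℕ} (hj : j + 1 < d) (c : ℕ) :
    partialPsi q α n (Function.update y ⟨j + 1, hj⟩ c) (j + 2) =
      hahnFun q (n ⟨j, by omega⟩) ((psum y (j + 1) : ℕ) - (psum n j : ℕ) : ℤ) (coupledParam α n j)
        (α ⟨j + 1, hj⟩) ((psum y (j + 1) + c : ℕ) - (psum n j : ℕ) : ℤ) *
      partialPsi q α n y (j + 1) := by
  rw [partialPsi_succ q α n _ (show j < d - 1 by omega), psiFactor, psum_succ _ hj,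
    psum_update_of_le y le_rfl, Function.update_self,
    partialPsi_congr (fun _ _ => rfl) fun m hm => psum_update_of_le y hm c, mul_comm]

theorem tailPsi_congr {n y y' : Fin d → ℕ} {k : ℕ} (hk : k ≤ d)
    (h : ∀ m, k ≤ m → psum y m = psum y' m) : tailPsi q α n y k = tailPsi q α n y' k := by
  rw [tailPsi, tailPsi, h d hk]
  congr 1
  refine Finset.prod_congr rfl fun j hj => ?_
  have hj := (Finset.mem_filter.1 hj).2
  rw [psiFactor, psiFactor, h _ (by omega), h _ (by omega)]

theorem partialPsi_eq_zero {n y : Fin d → ℕ} {j : ℕ} (hj : j < d)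
    (h : psum y (j + 1) < psum n j) : partialPsi q α n y (j + 1) = 0 := by
  cases j with
  | zero => simp [psum_zero] at h
  | succ j =>
    rw [psum_succ n (Nat.lt_of_succ_lt hj)] at h
    change psum y (j + 2) < _ at h
    have hzero : psiFactor q α n y ⟨j, by omega⟩ = 0 := hahnFun_eq_zero (by dsimp only; omega)
    rw [partialPsi_succ q α n y (by omega), hzero, mul_zero]

end PartialPsi

section Ladder

variable {d : ℕ} {q : ℝ} {α : Fin d → ℝ} {e : ℕ}

/-- The action of `A_+^S` (for `e = 0`) and of `A_-^S` (for `e = 1`) on coefficient functions: the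
coefficient of `A_± v` at `e_y` is a combination of the coefficients of `v` at the `e_z` with `z`
one step below (above) `y`. -/
noncomputable def ladderFun (q : ℝ) (α : Fin d → ℝ) (e : ℕ) (S : Finset (Fin d))
    (f : (Fin d → ℕ) → ℝ) (y : Fin d → ℕ) : ℝ :=
  ∑ i ∈ S, q ^ (∑ l ∈ S with l < i, weight (α l) (y l)) * √(sigma q (α i) (y i + e)) *
    f (stepAt e i y)

theorem ladderFun_eq_mul {S : Finset (Fin d)} {f g : (Fin d → ℕ) → ℝ} {y : Fin d → ℕ} {c : ℝ}
    (h : ∀ i ∈ S, y i + e ≠ 0 → f (stepAt e i y) = c * g (stepAt e i y)) :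
    ladderFun q α e S f y = c * ladderFun q α e S g y := by
  rw [ladderFun, ladderFun, Finset.mul_sum]
  refine Finset.sum_congr rfl fun i hi => ?_
  obtain h0 | h0 := eq_or_ne (y i + e) 0
  · simp only [h0, sigma_zero, Real.sqrt_zero, mul_zero, zero_mul]
  · rw [h i hi h0, mul_left_comm]

theorem ladderFun_initialSet_succ (f : (Fin d → ℕ) → ℝ) (y : Fin d → ℕ) {k : ℕ} (hk : k < d) :
    ladderFun q α e (initialSet d (k + 1)) f y = ladderFun q α e (initialSet d k) f y +
      q ^ ((psum y k : ℕ) + (psum α k + k) / 2 : ℝ) * √(sigma q (α ⟨k, hk⟩) (y ⟨k, hk⟩ + e)) *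
        f (stepAt e ⟨k, hk⟩ y) := by
  have hfilter (i : Fin d) (hi : i.val ≤ k) :
      ({l ∈ initialSet d (k + 1) | l < i} : Finset (Fin d)) = {l ∈ initialSet d k | l < i} := by
    ext l
    simp only [Finset.mem_filter, mem_initialSet, Fin.lt_def]
    omega
  have hlast : ({l ∈ initialSet d k | l < ⟨k, hk⟩} : Finset (Fin d)) = initialSet d k :=
    Finset.filter_true_of_mem fun l hl => mem_initialSet.1 hl
  rw [ladderFun, ladderFun, ← psum_weight α y hk.le, psum_eq_sum, Finset.sum_congr
    (initialSet_succ hk) fun _ _ => rfl, Finset.sum_cons, hfilter _ le_rfl, hlast, add_comm]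
  congr 1
  refine Finset.sum_congr rfl fun i hi => ?_
  rw [hfilter i (mem_initialSet.1 hi).le]

theorem partialPsi_stepAt_of_lt (n : Fin d → ℕ) {y : Fin d → ℕ} {j : ℕ} (hj : j + 1 < d)
    {i : Fin d} (hi : i < j + 1) (hy : y i + e ≠ 0) :
    partialPsi q α n (stepAt e i y) (j + 2) =
      hahnFun q (n ⟨j, by omega⟩) ((psum y (j + 1) : ℕ) - (psum n j : ℕ) + 2 * e - 1 : ℤ)
        (coupledParam α n j) (α ⟨j + 1, hj⟩)
        ((psum y (j + 2) : ℕ) - (psum n j : ℕ) + 2 * e - 1 : ℤ) *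
      partialPsi q α n (stepAt e i y) (j + 1) := by
  rw [partialPsi_succ q α n _ (show j < d - 1 by omega), psiFactor, psum_stepAt_of_lt hi hy,
    psum_stepAt_of_lt (Nat.lt_succ_of_lt hi) hy, mul_comm]
  congr 2 <;> ring

theorem partialPsi_stepAt_self (n : Fin d → ℕ) {y : Fin d → ℕ} {j : ℕ} (hj : j + 1 < d)
    (hy : y ⟨j + 1, hj⟩ + e ≠ 0) :
    partialPsi q α n (stepAt e ⟨j + 1, hj⟩ y) (j + 2) =
      hahnFun q (n ⟨j, by omega⟩) ((psum y (j + 1) : ℕ) - (psum n j : ℕ) : ℤ) (coupledParam α n j)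
        (α ⟨j + 1, hj⟩) ((psum y (j + 2) : ℕ) - (psum n j : ℕ) + 2 * e - 1 : ℤ) *
      partialPsi q α n y (j + 1) := by
  have hN : ((psum y (j + 1) + (y ⟨j + 1, hj⟩ + 2 * e - 1) : ℕ) : ℤ) - (psum n j : ℕ) =
      (psum y (j + 2) : ℕ) - (psum n j : ℕ) + 2 * e - 1 := by
    rw [psum_succ y hj]
    omega
  rw [stepAt, partialPsi_update_last, hN]

theorem ladderFun_partialPsi_succ (n y : Fin d → ℕ) {j : ℕ} (hj : j + 1 < d) :
    ladderFun q α e (initialSet d (j + 2)) (fun z => partialPsi q α n z (j + 2)) y =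
      hahnFun q (n ⟨j, by omega⟩) ((psum y (j + 1) : ℕ) - (psum n j : ℕ) + 2 * e - 1 : ℤ)
        (coupledParam α n j) (α ⟨j + 1, hj⟩)
        ((psum y (j + 2) : ℕ) - (psum n j : ℕ) + 2 * e - 1 : ℤ) *
        ladderFun q α e (initialSet d (j + 1)) (fun z => partialPsi q α n z (j + 1)) y +
      q ^ ((psum y (j + 1) : ℕ) + (psum α (j + 1) + (j + 1 : ℕ)) / 2 : ℝ) *
        √(sigma q (α ⟨j + 1, hj⟩) (y ⟨j + 1, hj⟩ + e)) *
        (hahnFun q (n ⟨j, by omega⟩) ((psum y (j + 1) : ℕ) - (psum n j : ℕ) : ℤ)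
          (coupledParam α n j) (α ⟨j + 1, hj⟩)
          ((psum y (j + 2) : ℕ) - (psum n j : ℕ) + 2 * e - 1 : ℤ) *
        partialPsi q α n y (j + 1)) := by
  rw [ladderFun_initialSet_succ _ _ hj]
  congr 1
  · exact ladderFun_eq_mul fun i hi hy => partialPsi_stepAt_of_lt n hj (mem_initialSet.1 hi) hy
  · obtain h0 | h0 := eq_or_ne (y ⟨j + 1, hj⟩ + e) 0
    · simp only [h0, sigma_zero, Real.sqrt_zero, mul_zero, zero_mul]
    · rw [partialPsi_stepAt_self n hj h0]

theorem psum_add_eq_weight_coupledParam (α : Fin d → ℝ) (n y : Fin d → ℕ) {j x : ℕ}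
    (hx : psum y (j + 1) = psum n j + x) :
    ((psum y (j + 1) : ℕ) + (psum α (j + 1) + (j + 1 : ℕ)) / 2 : ℝ) =
      weight (coupledParam α n j) x := by
  rw [weight, coupledParam, hx]
  push_cast
  ring

theorem ladderFun_partialPsi (hq0 : 0 < q) (hq1 : q < 1) (hα : Admissible α) (he : e ≤ 1)
    (n y : Fin d → ℕ) {j : ℕ} (hj : j < d) :
    ladderFun q α e (initialSet d (j + 1)) (fun z => partialPsi q α n z (j + 1)) y =
      √(sigma q (coupledParam α n j) (psum y (j + 1) - psum n j + e)) *
        partialPsi q α n y (j + 1) := by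
  induction j with
  | zero =>
    have hempty : initialSet d 0 = ∅ := by simp [initialSet]
    rw [ladderFun_initialSet_succ _ _ hj]
    simp [ladderFun, hempty, partialPsi_one, coupledParam, psum_zero, psum_succ _ hj]
  | succ j ih =>
    rw [ladderFun_partialPsi_succ n y hj, ih (by omega),
      partialPsi_succ q α n y (show j < d - 1 by omega), psiFactor]
    obtain hlt | ⟨x, hx⟩ : psum y (j + 1) < psum n j ∨ ∃ x, psum y (j + 1) = psum n j + x :=
      (lt_or_ge _ _).imp_right Nat.exists_eq_add_of_le
    · rw [partialPsi_eq_zero (by omega) hlt]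
      simp only [mul_zero, zero_mul, add_zero]
    have hladder := hahnFun_ladder hq0 hq1 (neg_one_lt_coupledParam hα.neg_one_lt n (by omega))
      (hα.neg_one_lt ⟨j + 1, hj⟩) (hα.coupledParam_add_ne_zero n hj) he (n ⟨j, by omega⟩) x
      (y ⟨j + 1, hj⟩)
    have hx' : ((psum y (j + 1) : ℕ) - (psum n j : ℕ) : ℤ) = x := by omega
    have hN : ((psum y (j + 2) : ℕ) - (psum n j : ℕ) : ℤ) = x + y ⟨j + 1, hj⟩ := by
      rw [psum_succ y hj]
      omega
    have hdiff : psum y (j + 1 + 1) - psum n (j + 1) = x + y ⟨j + 1, hj⟩ - n ⟨j, by omega⟩ := by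
      rw [psum_succ y hj, psum_succ n (Nat.lt_of_succ_lt hj)]
      omega
    rw [psum_add_eq_weight_coupledParam α n y hx, hx', hN, hdiff, coupledParam_succ α n hj, hx,
      Nat.add_sub_cancel_left]
    linear_combination partialPsi q α n y (j + 1) * hladder

end Ladder

section Casimir

variable {d : ℕ} {q : ℝ} {α : Fin d → ℝ}

theorem casimir_scalar_eq_gam (hq0 : 0 < q) (hq1 : q < 1) (a : ℝ) (n : ℕ) :
    ((q ^ (1 / 2 : ℝ) - q ^ (-1 / 2 : ℝ)) ^ 2)⁻¹ *
      (q ^ (-1 / 2 : ℝ) * q ^ weight a n + q ^ (1 / 2 : ℝ) * q ^ (-weight a n)) -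
      q * q ^ (-weight a n) * sigma q a n = gam q a := by
  set r := q ^ (1 / 2 : ℝ) with hr
  set t := q ^ (a / 2) with ht
  have hr0 : 0 < r := Real.rpow_pos_of_pos hq0 _
  have ht0 : 0 < t := Real.rpow_pos_of_pos hq0 _
  have hp0 : 0 < q ^ n := pow_pos hq0 n
  have hqr : q = r ^ 2 := by rw [hr, ← Real.rpow_mul_natCast hq0.le]; norm_num
  have hr_inv : q ^ (-1 / 2 : ℝ) = r⁻¹ := by rw [hr, ← Real.rpow_neg hq0.le, neg_div]
  have ht_inv : q ^ (-a / 2) = t⁻¹ := by rw [ht, ← Real.rpow_neg hq0.le, neg_div]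
  have hweight : q ^ weight a n = q ^ n * t * r := by
    rw [weight, add_div, Real.rpow_add hq0, Real.rpow_add hq0, Real.rpow_natCast, mul_assoc]
  have hsigma : q ^ ((n : ℝ) + a) = q ^ n * t ^ 2 := by
    rw [Real.rpow_add hq0, Real.rpow_natCast, ht, ← Real.rpow_mul_natCast hq0.le, Nat.cast_ofNat,
      div_mul_cancel₀ _ two_ne_zero]
  rw [gam, sigma, Real.rpow_neg hq0.le, hr_inv, ht_inv, hweight, hsigma]
  generalize q ^ n = p at *
  rw [← hr, ← ht, hqr]
  have hD : 1 - r ^ 2 ≠ 0 := by nlinarith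
  have hsub : r - r⁻¹ = -(1 - r ^ 2) / r := by field_simp; ring
  rw [hsub]
  field_simp
  ring

theorem psum_stepAt_stepAt {y : Fin d → ℕ} {i k : Fin d} {m : ℕ} (hi : i < m) (hk : k < m)
    (hy : y i ≠ 0) : psum (stepAt 1 k (stepAt 0 i y)) m = psum y m := by
  have h₁ := psum_stepAt_of_lt (e := 0) hi hy
  have h₂ := psum_stepAt_of_lt (e := 1) (y := stepAt 0 i y) hk (Nat.succ_ne_zero _)
  omega

theorem ladderFun_ladderFun_mul {S : Finset (Fin d)} {h f : (Fin d → ℕ) → ℝ} {y : Fin d → ℕ}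
    (hh : ∀ i ∈ S, ∀ k ∈ S, y i ≠ 0 → h (stepAt 1 k (stepAt 0 i y)) = h y) :
    ladderFun q α 0 S (ladderFun q α 1 S fun z => h z * f z) y =
      h y * ladderFun q α 0 S (ladderFun q α 1 S f) y :=
  ladderFun_eq_mul fun i hi hy => ladderFun_eq_mul fun k hk _ => by rw [hh i hi k hk hy]

theorem ladderFun_ladderFun_partialPsi (hq0 : 0 < q) (hq1 : q < 1) (hα : Admissible α)
    (n y : Fin d → ℕ) {j : ℕ} (hj : j < d) :
    ladderFun q α 0 (initialSet d (j + 1))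
        (ladderFun q α 1 (initialSet d (j + 1)) fun z => partialPsi q α n z (j + 1)) y =
      sigma q (coupledParam α n j) (psum y (j + 1) - psum n j) * partialPsi q α n y (j + 1) := by
  have hlower : ladderFun q α 1 (initialSet d (j + 1)) (fun z => partialPsi q α n z (j + 1)) =
      fun z => √(sigma q (coupledParam α n j) (psum z (j + 1) - psum n j + 1)) *
        partialPsi q α n z (j + 1) :=
    funext fun z => ladderFun_partialPsi hq0 hq1 hα le_rfl n z hj
  rw [hlower, ladderFun_eq_mul (c := √(sigma q (coupledParam α n j) (psum y (j + 1) - psum n j)))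
    (g := fun z => partialPsi q α n z (j + 1)), ladderFun_partialPsi hq0 hq1 hα zero_le_one n y hj,
    ← mul_assoc, add_zero, Real.mul_self_sqrt
      (sigma_nonneg hq0 hq1 (neg_one_lt_coupledParam hα.neg_one_lt n hj) _)]
  intro i hi hy
  have hpsum := psum_stepAt_of_lt (mem_initialSet.1 hi) hy
  obtain hlt | hle := lt_or_ge (psum (stepAt 0 i y) (j + 1)) (psum n j)
  · rw [partialPsi_eq_zero hj hlt, mul_zero, mul_zero]
  · rw [show psum (stepAt 0 i y) (j + 1) - psum n j + 1 = psum y (j + 1) - psum n j by omega]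

/-- The action of `q^{c A_0^S}` on coefficient functions. -/
noncomputable def qA0Fun (q : ℝ) (α : Fin d → ℝ) (S : Finset (Fin d)) (c : ℝ)
    (f : (Fin d → ℕ) → ℝ) (y : Fin d → ℕ) : ℝ :=
  q ^ (c * ∑ l ∈ S, weight (α l) (y l)) * f y

/-- The action of the Casimir operator `Γ^S` on coefficient functions. -/
noncomputable def casimirFun (q : ℝ) (α : Fin d → ℝ) (S : Finset (Fin d))
    (f : (Fin d → ℕ) → ℝ) (y : Fin d → ℕ) : ℝ :=
  ((q ^ (1 / 2 : ℝ) - q ^ (-1 / 2 : ℝ)) ^ 2)⁻¹ *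
      (q ^ (-1 / 2 : ℝ) * qA0Fun q α S 1 f y + q ^ (1 / 2 : ℝ) * qA0Fun q α S (-1) f y) -
    ladderFun q α 0 S (ladderFun q α 1 S fun z => q * qA0Fun q α S (-1) f z) y

theorem casimirFun_Psi (hq0 : 0 < q) (hq1 : q < 1) (hα : Admissible α) (n y : Fin d → ℕ)
    {j : ℕ} (hj : j < d) :
    casimirFun q α (initialSet d (j + 1)) (Psi q α n) y =
      gam q (coupledParam α n j) * Psi q α n y := by
  have hsum (z : Fin d → ℕ) : ∑ l ∈ initialSet d (j + 1), weight (α l) (z l) =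
      (psum z (j + 1) : ℕ) + (psum α (j + 1) + (j + 1 : ℕ)) / 2 := psum_weight α z hj
  have hsplit : (fun z => q * qA0Fun q α (initialSet d (j + 1)) (-1) (Psi q α n) z) = fun z =>
      q * q ^ (-1 * ((psum z (j + 1) : ℕ) + (psum α (j + 1) + (j + 1 : ℕ)) / 2 : ℝ)) *
        tailPsi q α n z (j + 1) * partialPsi q α n z (j + 1) := by
    funext z
    rw [qA0Fun, hsum, Psi_eq_partialPsi_mul_tailPsi q α n z (j + 1)]
    ring
  rw [casimirFun, hsplit, ladderFun_ladderFun_mul, ladderFun_ladderFun_partialPsi hq0 hq1 hα n y hj,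
    qA0Fun, qA0Fun, hsum, Psi_eq_partialPsi_mul_tailPsi q α n y (j + 1)]
  · obtain hlt | ⟨x, hx⟩ : psum y (j + 1) < psum n j ∨ ∃ x, psum y (j + 1) = psum n j + x :=
      (lt_or_ge _ _).imp_right Nat.exists_eq_add_of_le
    · simp only [partialPsi_eq_zero hj hlt, mul_zero, zero_mul, add_zero, sub_zero]
    · rw [psum_add_eq_weight_coupledParam α n y hx, hx, Nat.add_sub_cancel_left,
        ← casimir_scalar_eq_gam hq0 hq1 _ x, one_mul, neg_one_mul]
      ring
  · intro i hi k hk hy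
    have hpsum (m : ℕ) (hm : j + 1 ≤ m) : psum (stepAt 1 k (stepAt 0 i y)) m = psum y m :=
      psum_stepAt_stepAt ((mem_initialSet.1 hi).trans_le hm) ((mem_initialSet.1 hk).trans_le hm) hy
    rw [hpsum _ le_rfl, tailPsi_congr hj hpsum]

end Casimir

section Orthogonality

variable {d : ℕ} {q : ℝ} {α : Fin d → ℝ}

theorem sum_piAntidiag_initialSet_succ {M : Type*} [AddCommMonoid M] {k : ℕ} (hk : k < d)
    (f : (Fin d → ℕ) → M) (N : ℕ) :
    ∑ y ∈ Finset.piAntidiag (initialSet d (k + 1)) N, f y =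
      ∑ p ∈ antidiagonal N, ∑ y ∈ Finset.piAntidiag (initialSet d k) p.1,
        f (Function.update y ⟨k, hk⟩ p.2) := by
  rw [initialSet_succ hk, Finset.piAntidiag_cons, Finset.sum_disjiUnion,
    ← Finset.Nat.sum_antidiagonal_swap]
  refine Finset.sum_congr rfl fun p _ => ?_
  rw [Finset.sum_map]
  refine Finset.sum_congr rfl fun y hy => congrArg f (funext fun i => ?_)
  obtain rfl | hi := eq_or_ne i ⟨k, hk⟩
  · have hzero : y ⟨k, hk⟩ = 0 := by
      by_contra hne
      exact (mem_initialSet.1 ((Finset.mem_piAntidiag.1 hy).2 _ hne)).false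
    simp [hzero]
  · simp [hi]

theorem sum_hahnFun_sub_mul {a b : ℝ} (hq0 : 0 < q) (hq1 : q < 1) (ha : -1 < a) (hb : -1 < b)
    (hab : a + b + 1 ≠ 0) (n m s N : ℕ) :
    ∑ p ∈ antidiagonal N, hahnFun q n ((p.1 : ℤ) - s) a b ((N : ℤ) - s) *
        hahnFun q m ((p.1 : ℤ) - s) a b ((N : ℤ) - s) =
      if n = m ∧ s + n ≤ N then 1 else 0 := by
  obtain hlt | hle : N < s + n ∨ s + n ≤ N := lt_or_ge _ _
  · rw [if_neg (by omega)]
    exact Finset.sum_eq_zero fun p _ => by rw [hahnFun_eq_zero (n := n) (by omega), zero_mul]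
  obtain hlt' | hle' : N < s + m ∨ s + m ≤ N := lt_or_ge _ _
  · rw [if_neg (by omega)]
    exact Finset.sum_eq_zero fun p _ => by rw [hahnFun_eq_zero (n := m) (by omega), mul_zero]
  have hfilter : ∀ p ∈ antidiagonal N, hahnFun q n ((p.1 : ℤ) - s) a b ((N : ℤ) - s) *
      hahnFun q m ((p.1 : ℤ) - s) a b ((N : ℤ) - s) ≠ 0 → s ≤ p.1 := fun p _ hne => by
    contrapose! hne
    rw [hahnFun_eq_zero (by omega), zero_mul]
  have hshift (x : ℕ) : ((x + s : ℕ) : ℤ) - s = x := by push_cast; ring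
  rw [← Finset.sum_filter_of_ne hfilter, Finset.Nat.antidiagonal_filter_le_fst_of_le (by omega),
    Finset.sum_map]
  have hN : (N : ℤ) - s = (N - s : ℕ) := by omega
  simp only [Function.Embedding.coe_prodMap, Prod.map, Function.Embedding.coeFn_mk, hshift, hN]
  rw [sum_hahnFun_mul hq0 hq1 ha hb hab (by omega) (by omega)]
  simp only [hle, and_true]

theorem psum_congr {M : Type*} [AddCommMonoid M] {v w : Fin d → M} {k : ℕ}
    (h : ∀ i : Fin d, i < k → v i = w i) : psum v k = psum w k :=
  Finset.sum_congr rfl fun i hi => h i (mem_initialSet.1 hi)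

theorem forall_lt_succ_iff {M : Type*} {v w : Fin d → M} {k : ℕ} (hk : k < d) :
    (∀ i : Fin d, i < k + 1 → v i = w i) ↔
      (∀ i : Fin d, i < k → v i = w i) ∧ v ⟨k, hk⟩ = w ⟨k, hk⟩ := by
  refine ⟨fun h => ⟨fun i hi => h i (by omega), h _ k.lt_succ_self⟩, fun h i hi => ?_⟩
  obtain hlt | heq := Nat.lt_succ_iff_lt_or_eq.1 hi
  · exact h.1 i hlt
  · obtain rfl : i = ⟨k, hk⟩ := Fin.ext heq
    exact h.2

theorem sum_partialPsi_succ_mul (n m : Fin d → ℕ) {j : ℕ} (hj : j + 1 < d) (N : ℕ) :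
    ∑ y ∈ Finset.piAntidiag (initialSet d (j + 2)) N,
        partialPsi q α n y (j + 2) * partialPsi q α m y (j + 2) =
      ∑ p ∈ antidiagonal N,
        hahnFun q (n ⟨j, by omega⟩) ((p.1 : ℤ) - (psum n j : ℕ)) (coupledParam α n j)
          (α ⟨j + 1, hj⟩) ((N : ℤ) - (psum n j : ℕ)) *
        hahnFun q (m ⟨j, by omega⟩) ((p.1 : ℤ) - (psum m j : ℕ)) (coupledParam α m j)
          (α ⟨j + 1, hj⟩) ((N : ℤ) - (psum m j : ℕ)) *
        ∑ y ∈ Finset.piAntidiag (initialSet d (j + 1)) p.1,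
          partialPsi q α n y (j + 1) * partialPsi q α m y (j + 1) := by
  rw [sum_piAntidiag_initialSet_succ hj]
  refine Finset.sum_congr rfl fun p hp => ?_
  rw [Finset.mul_sum]
  refine Finset.sum_congr rfl fun y hy => ?_
  have hy : psum y (j + 1) = p.1 := (Finset.mem_piAntidiag.1 hy).1
  rw [partialPsi_update_last, partialPsi_update_last, hy, mem_antidiagonal.1 hp]
  ring

theorem sum_partialPsi_mul (hq0 : 0 < q) (hq1 : q < 1) (hα : Admissible α) (n m : Fin d → ℕ)
    {j : ℕ} (hj : j < d) (N : ℕ) :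
    ∑ y ∈ Finset.piAntidiag (initialSet d (j + 1)) N,
        partialPsi q α n y (j + 1) * partialPsi q α m y (j + 1) =
      if (∀ i : Fin d, i < j → n i = m i) ∧ psum n j ≤ N then 1 else 0 := by
  induction j generalizing N with
  | zero =>
    have hempty : initialSet d 0 = ∅ := by simp [initialSet]
    have hmem : ((0, N) : ℕ × ℕ) ∈ antidiagonal N := mem_antidiagonal.2 (zero_add N)
    simp only [sum_piAntidiag_initialSet_succ hj, zero_add, partialPsi_one, hempty, psum_zero]
    rw [Finset.sum_eq_single_of_mem _ hmem fun p hp hne => ?_]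
    · simp
    · have : p.1 ≠ 0 := fun h => hne (Prod.ext h (by have := mem_antidiagonal.1 hp; omega))
      simp [this]
  | succ j ih =>
    have hj' : j < d := Nat.lt_of_succ_lt hj
    rw [sum_partialPsi_succ_mul n m hj]
    simp only [ih hj', forall_lt_succ_iff hj']
    by_cases hagree : ∀ i : Fin d, i < j → n i = m i
    · have hpsum : psum n j = psum m j := psum_congr hagree
      have hparam : coupledParam α m j = coupledParam α n j := by
        rw [coupledParam, coupledParam, hpsum]
      simp only [eq_true hagree, true_and, hparam, ← hpsum]
      rw [psum_succ n hj', ← sum_hahnFun_sub_mul hq0 hq1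
        (neg_one_lt_coupledParam hα.neg_one_lt n hj') (hα.neg_one_lt _)
        (hα.coupledParam_add_ne_zero n hj)]
      refine Finset.sum_congr rfl fun p _ => ?_
      obtain hlt | hle := lt_or_ge p.1 (psum n j)
      · rw [hahnFun_eq_zero (by omega), zero_mul, zero_mul]
      · rw [if_pos hle, mul_one]
    · simp [hagree]

theorem mem_piAntidiag_univ {v : Fin d → ℕ} {N : ℕ} :
    v ∈ Finset.piAntidiag Finset.univ N ↔ psum v d = N := by
  simp [psum_self]

theorem Psi_eq_zero {n y : Fin d → ℕ} (h : psum n d ≠ psum y d) : Psi q α n y = 0 := by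
  rw [Psi, if_neg h, zero_mul]

theorem sum_piAntidiag_Psi_mul (hq0 : 0 < q) (hq1 : q < 1) (hα : Admissible α) {N : ℕ}
    {n m : Fin d → ℕ} (hn : psum n d = N) (hm : psum m d = N) :
    ∑ y ∈ Finset.piAntidiag Finset.univ N, Psi q α n y * Psi q α m y = if n = m then 1 else 0 := by
  have hpartial : ∀ y ∈ Finset.piAntidiag Finset.univ N,
      Psi q α n y * Psi q α m y = partialPsi q α n y d * partialPsi q α m y d := fun y hy => by
    have hy := mem_piAntidiag_univ.1 hy
    rw [Psi_eq_partialPsi, Psi_eq_partialPsi, if_pos (hn.trans hy.symm), if_pos (hm.trans hy.symm)]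
  rw [Finset.sum_congr rfl hpartial]
  cases d with
  | zero =>
    obtain rfl : N = 0 := hn.symm.trans (psum_zero n)
    simp [partialPsi, Subsingleton.elim n m]
  | succ j =>
    rw [← initialSet_self, sum_partialPsi_mul hq0 hq1 hα n m j.lt_succ_self]
    have hn' := psum_succ n j.lt_succ_self
    have hm' := psum_succ m j.lt_succ_self
    refine if_congr ⟨fun h => ?_, ?_⟩ rfl rfl
    · have hpsum := psum_congr h.1
      exact funext fun i => (forall_lt_succ_iff j.lt_succ_self).2 ⟨h.1, by omega⟩ i i.isLt
    · rintro rfl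
      exact ⟨fun _ _ => rfl, by omega⟩

-- In a fixed degree the rows of the square matrix `Ψ` are orthonormal, hence so are its columns.
theorem sum_piAntidiag_Psi_mul' (hq0 : 0 < q) (hq1 : q < 1) (hα : Admissible α) {N : ℕ}
    {y z : Fin d → ℕ} (hy : psum y d = N) (hz : psum z d = N) :
    ∑ n ∈ Finset.piAntidiag Finset.univ N, Psi q α n y * Psi q α n z = if y = z then 1 else 0 := by
  let S : Finset (Fin d → ℕ) := Finset.piAntidiag Finset.univ N
  let U : Matrix S S ℝ := Matrix.of fun n y => Psi q α n y
  have hU : U * U.transpose = 1 := by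
    ext n m
    rw [Matrix.mul_apply, Matrix.one_apply]
    simp only [Subtype.ext_iff]
    rw [← sum_piAntidiag_Psi_mul hq0 hq1 hα (mem_piAntidiag_univ.1 n.2)
      (mem_piAntidiag_univ.1 m.2)]
    exact Finset.sum_coe_sort S fun y => Psi q α n y * Psi q α m y
  have hentry := congr_fun₂ (mul_eq_one_comm.1 hU : U.transpose * U = 1)
    ⟨y, mem_piAntidiag_univ.2 hy⟩ ⟨z, mem_piAntidiag_univ.2 hz⟩
  rw [Matrix.mul_apply, Matrix.one_apply] at hentry
  simp only [Subtype.mk.injEq] at hentry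
  rw [← hentry]
  exact (Finset.sum_coe_sort S fun n => Psi q α n y * Psi q α n z).symm

theorem sum_Psi_mul (hq0 : 0 < q) (hq1 : q < 1) (hα : Admissible α) (n m : Fin d → ℕ) :
    ∑ y ∈ Finset.piAntidiag Finset.univ (psum n d), Psi q α n y * Psi q α m y =
      if n = m then 1 else 0 := by
  obtain h | h := eq_or_ne (psum m d) (psum n d)
  · exact sum_piAntidiag_Psi_mul hq0 hq1 hα rfl h
  · rw [if_neg fun heq => h (by rw [heq])]
    refine Finset.sum_eq_zero fun y hy => ?_
    rw [Psi_eq_zero (n := m) (by rwa [mem_piAntidiag_univ.1 hy]), mul_zero]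

theorem sum_Psi_mul' (hq0 : 0 < q) (hq1 : q < 1) (hα : Admissible α) (y z : Fin d → ℕ) :
    ∑ n ∈ Finset.piAntidiag Finset.univ (psum y d), Psi q α n y * Psi q α n z =
      if y = z then 1 else 0 := by
  obtain h | h := eq_or_ne (psum z d) (psum y d)
  · exact sum_piAntidiag_Psi_mul' hq0 hq1 hα rfl h
  · rw [if_neg fun heq => h (by rw [heq])]
    refine Finset.sum_eq_zero fun n hn => ?_
    rw [Psi_eq_zero (y := z) (by rw [mem_piAntidiag_univ.1 hn]; exact h.symm), mul_zero]

theorem finsum_eq_sum_piAntidiag {M : Type*} [AddCommMonoid M] {f : (Fin d → ℕ) → M} {N : ℕ}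
    (hf : ∀ y, psum y d ≠ N → f y = 0) :
    ∑ᶠ y, f y = ∑ y ∈ Finset.piAntidiag Finset.univ N, f y := by
  refine finsum_eq_sum_of_support_subset f fun y hy => mem_piAntidiag_univ.2 ?_
  contrapose! hy
  exact Function.notMem_support.2 (hf y hy)

theorem finsum_Psi_mul (hq0 : 0 < q) (hq1 : q < 1) (hα : Admissible α) (n m : Fin d → ℕ) :
    ∑ᶠ y, Psi q α n y * Psi q α m y = if n = m then 1 else 0 := by
  rw [finsum_eq_sum_piAntidiag fun y hy => by rw [Psi_eq_zero hy.symm, zero_mul],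
    sum_Psi_mul hq0 hq1 hα]

theorem finsum_Psi_mul' (hq0 : 0 < q) (hq1 : q < 1) (hα : Admissible α) (y z : Fin d → ℕ) :
    ∑ᶠ n, Psi q α n y * Psi q α n z = if y = z then 1 else 0 := by
  rw [finsum_eq_sum_piAntidiag fun n hn => by rw [Psi_eq_zero hn, zero_mul],
    sum_Psi_mul' hq0 hq1 hα]

theorem finite_of_forall_psum_eq {s : Set (Fin d → ℕ)} {N : ℕ} (h : ∀ y ∈ s, psum y d = N) :
    s.Finite :=
  (Finset.piAntidiag Finset.univ N).finite_toSet.subset fun y hy => mem_piAntidiag_univ.2 (h y hy)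

theorem finite_setOf_Psi_ne_zero (n : Fin d → ℕ) : {y | Psi q α n y ≠ 0}.Finite :=
  finite_of_forall_psum_eq fun _ hy => (not_imp_comm.1 Psi_eq_zero hy).symm

theorem finite_setOf_Psi_ne_zero' (y : Fin d → ℕ) : {n | Psi q α n y ≠ 0}.Finite :=
  finite_of_forall_psum_eq fun _ hn => not_imp_comm.1 Psi_eq_zero hn

end Orthogonality

section TensorProduct

variable {𝕜 : Type*} [RCLike 𝕜] {d : ℕ} {q : ℝ} {α : Fin d → ℝ}

theorem repr_prodBasis (y z : Fin d → ℕ) :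
    (prodBasis 𝕜 d).repr (prodBasis 𝕜 d y) z = if y = z then 1 else 0 := by
  rw [Module.Basis.repr_self, Finsupp.single_apply]

theorem repr_map {f : Fin d → Module.End 𝕜 (V 𝕜)} {y z : Fin d → ℕ} {c : Fin d → 𝕜}
    (h : ∀ i x, f i (Finsupp.single x 1) (y i) = if x = z i then c i else 0) (v : W 𝕜 d) :
    (prodBasis 𝕜 d).repr (PiTensorProduct.map f v) y = (∏ i, c i) * (prodBasis 𝕜 d).repr v z := by
  suffices (prodBasis 𝕜 d).coord y ∘ₗ PiTensorProduct.map f = (∏ i, c i) • (prodBasis 𝕜 d).coord z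
    from LinearMap.congr_fun this v
  refine (prodBasis 𝕜 d).ext fun x => ?_
  simp only [LinearMap.comp_apply, LinearMap.smul_apply, Module.Basis.coord_apply, repr_prodBasis]
  rw [prodBasis_apply, PiTensorProduct.map_tprod, prodBasis, Basis.piTensorProduct_repr_tprod_apply]
  simp only [Finsupp.basisSingleOne_repr, LinearEquiv.refl_apply, h, Finset.prod_ite_zero,
    Finset.mem_univ, true_imp_iff, funext_iff, smul_eq_mul, mul_ite, mul_one, mul_zero]

theorem repr_site {T : Module.End 𝕜 (V 𝕜)} {k : Fin d} {y : Fin d → ℕ} {m : ℕ} {c : 𝕜}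
    (h : ∀ x, T (Finsupp.single x 1) (y k) = if x = m then c else 0) (v : W 𝕜 d) :
    (prodBasis 𝕜 d).repr (site 𝕜 k T v) y =
      c * (prodBasis 𝕜 d).repr v (Function.update y k m) := by
  rw [site, repr_map (c := Function.update 1 k c) (z := Function.update y k m),
    Finset.prod_update_of_mem (Finset.mem_univ k)]
  · simp
  · intro i x
    obtain rfl | hi := eq_or_ne i k
    · simpa using h x
    · simp [hi, Finsupp.single_apply]

theorem repr_site_Aplus (q a : ℝ) (k : Fin d) (v : W 𝕜 d) (y : Fin d → ℕ) :
    (prodBasis 𝕜 d).repr (site 𝕜 k (Aplus 𝕜 q a) v) y =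
      (√(sigma q a (y k)) : 𝕜) * (prodBasis 𝕜 d).repr v (stepAt 0 k y) := by
  refine repr_site (fun x => ?_) v
  simp only [Aplus, Finsupp.linearCombination_single, one_smul, Finsupp.smul_apply,
    Finsupp.single_apply, smul_eq_mul, mul_ite, mul_one, mul_zero]
  obtain h0 | h0 := eq_or_ne (y k) 0
  · simp [h0, sigma_zero]
  · by_cases hx : x + 1 = y k
    · rw [if_pos hx, if_pos (by omega), hx]
    · rw [if_neg hx, if_neg (by omega)]

theorem repr_site_Aminus (q a : ℝ) (k : Fin d) (v : W 𝕜 d) (y : Fin d → ℕ) :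
    (prodBasis 𝕜 d).repr (site 𝕜 k (Aminus 𝕜 q a) v) y =
      (√(sigma q a (y k + 1)) : 𝕜) * (prodBasis 𝕜 d).repr v (stepAt 1 k y) := by
  refine repr_site (fun x => ?_) v
  simp only [Aminus, Finsupp.linearCombination_single, one_smul, Finsupp.smul_apply,
    Finsupp.single_apply, smul_eq_mul, mul_ite, mul_one, mul_zero]
  cases x with
  | zero => simp [sigma_zero]
  | succ x =>
    rw [Nat.add_sub_cancel]
    by_cases hx : x = y k
    · rw [if_pos hx, if_pos (by omega), hx]
    · rw [if_neg hx, if_neg (by omega)]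

theorem repr_qA0On (hq0 : 0 < q) (S : Finset (Fin d)) (c : ℝ) {v : W 𝕜 d} {f : (Fin d → ℕ) → ℝ}
    (hv : ∀ y, (prodBasis 𝕜 d).repr v y = (f y : 𝕜)) (y : Fin d → ℕ) :
    (prodBasis 𝕜 d).repr (qA0On 𝕜 q α S c v) y = (qA0Fun q α S c f y : 𝕜) := by
  rw [qA0On, repr_map (z := y)
    (c := fun i => if i ∈ S then ((q ^ (c * weight (α i) (y i)) : ℝ) : 𝕜) else 1), hv, qA0Fun,
    Finset.prod_ite_mem, Finset.univ_inter, Finset.mul_sum, Real.rpow_sum_of_pos hq0]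
  · push_cast
    rfl
  · intro i x
    by_cases hi : i ∈ S <;> obtain rfl | hx := eq_or_ne x (y i) <;>
      simp [qA0, Algebra.smul_def, *]

theorem repr_AplusOn (hq0 : 0 < q) (S : Finset (Fin d)) {v : W 𝕜 d} {f : (Fin d → ℕ) → ℝ}
    (hv : ∀ y, (prodBasis 𝕜 d).repr v y = (f y : 𝕜)) (y : Fin d → ℕ) :
    (prodBasis 𝕜 d).repr (AplusOn 𝕜 q α S v) y = (ladderFun q α 0 S f y : 𝕜) := by
  have hsite (k : Fin d) (z : Fin d → ℕ) :
      (prodBasis 𝕜 d).repr (site 𝕜 k (Aplus 𝕜 q (α k)) v) z =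
        ((√(sigma q (α k) (z k)) * f (stepAt 0 k z) : ℝ) : 𝕜) := by
    rw [repr_site_Aplus, hv, RCLike.ofReal_mul]
  simp only [AplusOn, LinearMap.sum_apply, Module.End.mul_apply, map_sum, Finsupp.finsetSum_apply,
    repr_qA0On hq0 _ _ (hsite _), qA0Fun, one_mul, ladderFun, mul_assoc,
    add_zero]

theorem repr_AminusOn (hq0 : 0 < q) (S : Finset (Fin d)) {v : W 𝕜 d} {f : (Fin d → ℕ) → ℝ}
    (hv : ∀ y, (prodBasis 𝕜 d).repr v y = (f y : 𝕜)) (y : Fin d → ℕ) :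
    (prodBasis 𝕜 d).repr (AminusOn 𝕜 q α S v) y = (ladderFun q α 1 S f y : 𝕜) := by
  have hsite (k : Fin d) (z : Fin d → ℕ) :
      (prodBasis 𝕜 d).repr (site 𝕜 k (Aminus 𝕜 q (α k)) v) z =
        ((√(sigma q (α k) (z k + 1)) * f (stepAt 1 k z) : ℝ) : 𝕜) := by
    rw [repr_site_Aminus, hv, RCLike.ofReal_mul]
  simp only [AminusOn, LinearMap.sum_apply, Module.End.mul_apply, map_sum, Finsupp.finsetSum_apply,
    repr_qA0On hq0 _ _ (hsite _), qA0Fun, one_mul, ladderFun, mul_assoc]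

theorem repr_casimir (hq0 : 0 < q) (S : Finset (Fin d)) {v : W 𝕜 d} {f : (Fin d → ℕ) → ℝ}
    (hv : ∀ y, (prodBasis 𝕜 d).repr v y = (f y : 𝕜)) (y : Fin d → ℕ) :
    (prodBasis 𝕜 d).repr (casimir 𝕜 q α S v) y = (casimirFun q α S f y : 𝕜) := by
  have hscaled (z : Fin d → ℕ) : (prodBasis 𝕜 d).repr ((q : 𝕜) • qA0On 𝕜 q α S (-1) v) z =
      ((q * qA0Fun q α S (-1) f z : ℝ) : 𝕜) := by
    rw [map_smul, Finsupp.smul_apply, repr_qA0On hq0 S _ hv, smul_eq_mul, RCLike.ofReal_mul]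
  have hladder := repr_AplusOn (α := α) hq0 S (repr_AminusOn (α := α) hq0 S hscaled) y
  simp only [casimir, LinearMap.add_apply, LinearMap.smul_apply, Module.End.mul_apply, map_add,
    map_smul, Finsupp.add_apply, Finsupp.smul_apply, smul_eq_mul, repr_qA0On hq0 S _ hv, casimirFun,
    RCLike.ofReal_sub, RCLike.ofReal_mul, ← hladder]
  ring

/-- The vector `∑_y Ψ_n(y) e_y` of `W^{(α)}`, the member of index `n` of the coupled basis that is
constructed here. The finite range of summation contains the support of `Ψ_n`. -/
noncomputable def psiVec (𝕜 : Type*) [RCLike 𝕜] (q : ℝ) (α : Fin d → ℝ) (n : Fin d → ℕ) : W 𝕜 d :=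
  ∑ y ∈ Finset.piAntidiag Finset.univ (psum n d), (Psi q α n y : 𝕜) • prodBasis 𝕜 d y

theorem repr_psiVec (n y : Fin d → ℕ) :
    (prodBasis 𝕜 d).repr (psiVec 𝕜 q α n) y = (Psi q α n y : 𝕜) := by
  simp only [psiVec, map_sum, map_smul, Finsupp.finsetSum_apply, Finsupp.smul_apply, repr_prodBasis,
    smul_eq_mul, mul_ite, mul_one, mul_zero, Finset.sum_ite_eq', mem_piAntidiag_univ]
  refine ite_eq_left_iff.2 fun h => ?_
  rw [Psi_eq_zero (Ne.symm h), RCLike.ofReal_zero]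

theorem innerW_psiVec (hq0 : 0 < q) (hq1 : q < 1) (hα : Admissible α) (n m : Fin d → ℕ) :
    innerW (psiVec 𝕜 q α n) (psiVec 𝕜 q α m) = if n = m then 1 else 0 := by
  have hsupp : ((prodBasis 𝕜 d).repr (psiVec 𝕜 q α n)).support ⊆
      Finset.piAntidiag Finset.univ (psum n d) := fun y hy => by
    contrapose! hy
    rw [Finsupp.notMem_support_iff, repr_psiVec,
      Psi_eq_zero fun h => hy (mem_piAntidiag_univ.2 h.symm), RCLike.ofReal_zero]
  rw [innerW, Finsupp.sum_of_support_subset _ hsupp _ fun _ _ => by rw [map_zero, zero_mul]]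
  simp only [repr_psiVec, RCLike.conj_ofReal, ← RCLike.ofReal_mul, ← RCLike.ofReal_sum]
  rw [sum_Psi_mul hq0 hq1 hα]
  split_ifs <;> simp

theorem hasPsiExpansions_psiVec (hq0 : 0 < q) (hq1 : q < 1) (hα : Admissible α) :
    HasPsiExpansions q α (psiVec 𝕜 q α) := by
  refine ⟨fun n => ?_, fun z => ?_⟩
  · refine (finsum_eq_sum_piAntidiag fun y hy => ?_).symm
    rw [Psi_eq_zero hy.symm, RCLike.ofReal_zero, zero_smul]
  · rw [finsum_eq_sum_piAntidiag (N := psum z d) fun n hn => by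
      rw [Psi_eq_zero hn, RCLike.ofReal_zero, zero_smul]]
    refine (prodBasis 𝕜 d).ext_elem fun y => ?_
    simp only [repr_prodBasis, map_sum, map_smul, Finsupp.finsetSum_apply, Finsupp.smul_apply,
      repr_psiVec, smul_eq_mul, ← RCLike.ofReal_mul]
    rw [← RCLike.ofReal_sum, sum_Psi_mul' hq0 hq1 hα]
    split_ifs <;> simp

theorem coupledParam_sub_one (n : Fin d → ℕ) {k : ℕ} (hk : k ≠ 0) :
    2 * ((psum n (k - 1) : ℕ) : ℝ) + psum α k + k - 1 = coupledParam α n (k - 1) := by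
  obtain ⟨j, rfl⟩ := Nat.exists_eq_succ_of_ne_zero hk
  rw [Nat.succ_eq_add_one, Nat.add_sub_cancel, coupledParam]
  push_cast
  ring

theorem casimir_psiVec (hq0 : 0 < q) (hq1 : q < 1) (hα : Admissible α) (n : Fin d → ℕ) {j : ℕ}
    (hj : j < d) : casimir 𝕜 q α (initialSet d (j + 1)) (psiVec 𝕜 q α n) =
      (gam q (coupledParam α n j) : 𝕜) • psiVec 𝕜 q α n := by
  refine (prodBasis 𝕜 d).ext_elem fun y => ?_
  rw [repr_casimir hq0 _ (repr_psiVec n), casimirFun_Psi hq0 hq1 hα n y hj, map_smul,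
    Finsupp.smul_apply, repr_psiVec, RCLike.ofReal_mul, smul_eq_mul]

theorem qA0On_psiVec (hq0 : 0 < q) (n : Fin d → ℕ) :
    qA0On 𝕜 q α (initialSet d d) 1 (psiVec 𝕜 q α n) =
      ((q ^ ((psum n d : ℕ) + (psum α d + d) / 2 : ℝ) : ℝ) : 𝕜) • psiVec 𝕜 q α n := by
  refine (prodBasis 𝕜 d).ext_elem fun y => ?_
  have hweight : ∑ l ∈ initialSet d d, weight (α l) (y l) = (psum y d : ℕ) + (psum α d + d) / 2 :=
    psum_weight α y le_rfl
  rw [repr_qA0On hq0 _ _ (repr_psiVec n), map_smul, Finsupp.smul_apply, repr_psiVec, smul_eq_mul,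
    ← RCLike.ofReal_mul, qA0Fun, one_mul, hweight]
  obtain h | h := eq_or_ne (psum n d) (psum y d)
  · rw [h]
  · rw [Psi_eq_zero h, mul_zero, mul_zero]

theorem isCoupledBasis_psiVec (hq0 : 0 < q) (hq1 : q < 1) (hα : Admissible α) :
    IsCoupledBasis q α (psiVec 𝕜 q α) where
  orthonormal := innerW_psiVec hq0 hq1 hα
  span_eq_top := by
    rw [eq_top_iff, ← (prodBasis 𝕜 d).span_eq, Submodule.span_le]
    rintro _ ⟨y, rfl⟩
    rw [(hasPsiExpansions_psiVec hq0 hq1 hα).2 y]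
    exact finsum_induction (· ∈ Submodule.span 𝕜 (Set.range (psiVec 𝕜 q α)))
      (Submodule.zero_mem _) (fun _ _ => Submodule.add_mem _) fun n =>
        Submodule.smul_mem _ _ (Submodule.subset_span (Set.mem_range_self n))
  casimir_eigen n k hk := by
    obtain ⟨hk2, hkd⟩ := Finset.mem_Icc.1 hk
    rw [coupledParam_sub_one n (by omega), ← casimir_psiVec hq0 hq1 hα n (by omega),
      Nat.sub_add_cancel (by omega)]
  qA0_eigen := qA0On_psiVec hq0

end TensorProduct

section Uniqueness

variable {𝕜 : Type*} [RCLike 𝕜] {d : ℕ} {q : ℝ} {α : Fin d → ℝ}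

theorem abs_eq_abs_of_gam_eq (hq0 : 0 < q) (hq1 : q < 1) {a b : ℝ} (h : gam q a = gam q b) :
    |a| = |b| := by
  have hlog : Real.log q ≠ 0 := (Real.log_neg hq0 hq1).ne
  have hdenom : (q ^ (1 / 2 : ℝ) - q ^ (-1 / 2 : ℝ)) ^ 2 ≠ 0 :=
    pow_ne_zero 2
      (sub_neg.2 (Real.rpow_lt_rpow_of_exponent_gt hq0 hq1 (by norm_num))).ne
  have hcosh (c : ℝ) : q ^ (c / 2) + q ^ (-c / 2) = 2 * Real.cosh (Real.log q / 2 * c) := by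
    rw [Real.rpow_def_of_pos hq0, Real.rpow_def_of_pos hq0, Real.cosh_eq]
    ring_nf
  rw [gam, gam, div_left_inj' hdenom, hcosh, hcosh, mul_right_inj' two_ne_zero] at h
  have habs := Real.cosh_injOn (Set.mem_Ici.2 (abs_nonneg _)) (Set.mem_Ici.2 (abs_nonneg _))
    ((Real.cosh_abs _).trans (h.trans (Real.cosh_abs _).symm))
  rwa [abs_mul, abs_mul, mul_right_inj' (abs_ne_zero.2 (div_ne_zero hlog two_ne_zero))] at habs

theorem psum_eq_of_gam_coupledParam_eq (hq0 : 0 < q) (hq1 : q < 1) (hα : ∀ i, -1 < α i)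
    {n m : Fin d → ℕ} {j : ℕ} (hj : j < d)
    (h : gam q (coupledParam α n j) = gam q (coupledParam α m j)) : psum n j = psum m j := by
  have hlt := neg_one_lt_coupledParam hα 0 hj
  have hzero : psum (0 : Fin d → ℕ) j = 0 := Finset.sum_const_zero
  have habs := abs_eq_abs_of_gam_eq hq0 hq1 h
  rw [coupledParam, hzero, Nat.cast_zero] at hlt
  rw [coupledParam, coupledParam] at habs
  obtain heq | hneg := abs_eq_abs.1 habs
  · have : ((psum n j : ℕ) : ℝ) = (psum m j : ℕ) := by linarith
    exact_mod_cast this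
  · have : ((psum n j : ℕ) : ℝ) + (psum m j : ℕ) < 1 := by linarith
    norm_cast at this
    omega

theorem eq_of_psum_eq {n m : Fin d → ℕ} (h : ∀ k ≤ d, psum n k = psum m k) : n = m := by
  funext i
  have hsucc := h (i + 1) i.2
  rwa [psum_succ n i.2, psum_succ m i.2, h i i.2.le, Nat.add_left_cancel_iff] at hsucc

theorem eq_of_eigenvalues_eq (hq0 : 0 < q) (hq1 : q < 1) (hα : ∀ i, -1 < α i) {n m : Fin d → ℕ}
    (hcasimir : ∀ k ∈ Finset.Icc 2 d,
      gam q (2 * ((psum n (k - 1) : ℕ) : ℝ) + psum α k + k - 1) =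
        gam q (2 * ((psum m (k - 1) : ℕ) : ℝ) + psum α k + k - 1))
    (hqA0 : q ^ (((psum n d : ℕ) : ℝ) + (psum α d + d) / 2) =
      q ^ (((psum m d : ℕ) : ℝ) + (psum α d + d) / 2)) : n = m := by
  refine eq_of_psum_eq fun k hk => ?_
  obtain rfl | hkd := hk.eq_or_lt
  · exact_mod_cast add_right_cancel ((Real.rpow_right_inj hq0 hq1.ne).1 hqA0)
  obtain rfl | hk0 := k.eq_zero_or_pos
  · rw [psum_zero, psum_zero]
  · have h := hcasimir (k + 1) (Finset.mem_Icc.2 ⟨by omega, hkd⟩)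
    rw [coupledParam_sub_one n k.succ_ne_zero, coupledParam_sub_one m k.succ_ne_zero] at h
    exact psum_eq_of_gam_coupledParam_eq hq0 hq1 hα hkd h

theorem eigenvalue_eq_of_repr_ne_zero {ι K E : Type*} [Field K] [AddCommMonoid E] [Module K E]
    (b : Module.Basis ι K E) {T : Module.End K E} {l : ι → K} (hT : ∀ i, T (b i) = l i • b i)
    {v : E} {c : K} (hv : T v = c • v) {i : ι} (hi : b.repr v i ≠ 0) : l i = c := by
  have hcoord : b.coord i ∘ₗ T = l i • b.coord i := by
    refine b.ext fun j => ?_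
    obtain rfl | hj := eq_or_ne i j
    · simp [hT]
    · simp [hT, hj]
  have hrepr : b.repr (T v) i = l i * b.repr v i := LinearMap.congr_fun hcoord v
  rw [hv, map_smul, Finsupp.smul_apply, smul_eq_mul] at hrepr
  exact (mul_right_cancel₀ hi hrepr).symm

theorem exists_dual_eq_innerW (u : W 𝕜 d) : ∃ φ : Module.Dual 𝕜 (W 𝕜 d), ∀ v, φ v = innerW u v :=
  ⟨((prodBasis 𝕜 d).repr u).sum fun y c => conj c • (prodBasis 𝕜 d).coord y, fun v => by
    simp [Finsupp.sum, innerW]⟩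

theorem linearIndependent_of_innerW {ι : Type*} [DecidableEq ι] {g : ι → W 𝕜 d}
    (hg : ∀ i j, innerW (g i) (g j) = if i = j then 1 else 0) : LinearIndependent 𝕜 g := by
  choose φ hφ using fun i => exists_dual_eq_innerW (g i)
  refine LinearIndependent.of_pairwise_dual_eq_zero_one g φ (fun i j hij => ?_) fun i => ?_
  · simp only [hφ, hg, if_neg hij]
  · rw [hφ, hg, if_pos rfl]

theorem innerW_smul_smul (c : 𝕜) (u : W 𝕜 d) :
    innerW (c • u) (c • u) = (‖c‖ : 𝕜) ^ 2 * innerW u u := by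
  rw [innerW, innerW, map_smul, Finsupp.sum_smul_index fun _ => by rw [map_zero, zero_mul],
    Finsupp.mul_sum, ← RCLike.conj_mul]
  refine Finsupp.sum_congr fun y _ => ?_
  rw [map_mul, Finsupp.smul_apply, smul_eq_mul]
  ring

namespace IsCoupledBasis

variable {g g' : (Fin d → ℕ) → W 𝕜 d}

theorem norm_eq_one_of_eq_smul (hg : IsCoupledBasis q α g) (hg' : IsCoupledBasis q α g')
    {n : Fin d → ℕ} {c : 𝕜} (h : g n = c • g' n) : ‖c‖ = 1 := by
  have hsq := hg.orthonormal n n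
  rw [h, innerW_smul_smul, hg'.orthonormal, if_pos rfl, mul_one] at hsq
  exact (pow_eq_one_iff_of_nonneg (norm_nonneg c) two_ne_zero).1 (by exact_mod_cast hsq)

/-- A coupled basis as a basis of the vector space `W^{(α)}`. -/
noncomputable def toBasis (hg : IsCoupledBasis q α g) : Module.Basis (Fin d → ℕ) 𝕜 (W 𝕜 d) :=
  Module.Basis.mk (linearIndependent_of_innerW hg.orthonormal) hg.span_eq_top.ge

theorem toBasis_apply (hg : IsCoupledBasis q α g) (n : Fin d → ℕ) : hg.toBasis n = g n :=
  Module.Basis.mk_apply _ _ n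

theorem repr_eq_zero (hq0 : 0 < q) (hq1 : q < 1) (hα : ∀ i, -1 < α i)
    (hg : IsCoupledBasis q α g) (hg' : IsCoupledBasis q α g') {n m : Fin d → ℕ} (hnm : n ≠ m) :
    hg'.toBasis.repr (g m) n = 0 := by
  contrapose! hnm
  refine eq_of_eigenvalues_eq hq0 hq1 hα (fun k hk => ?_) ?_
  · have heigen (i : Fin d → ℕ) := hg'.casimir_eigen i k hk
    simp only [← hg'.toBasis_apply] at heigen
    exact RCLike.ofReal_injective
      (eigenvalue_eq_of_repr_ne_zero hg'.toBasis heigen (hg.casimir_eigen m k hk) hnm)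
  · have heigen := hg'.qA0_eigen
    simp only [← hg'.toBasis_apply] at heigen
    exact RCLike.ofReal_injective
      (eigenvalue_eq_of_repr_ne_zero hg'.toBasis heigen (hg.qA0_eigen m) hnm)

theorem exists_eq_smul (hq0 : 0 < q) (hq1 : q < 1) (hα : ∀ i, -1 < α i)
    (hg : IsCoupledBasis q α g) (hg' : IsCoupledBasis q α g') (m : Fin d → ℕ) :
    ∃ c : 𝕜, ‖c‖ = 1 ∧ g m = c • g' m := by
  suffices h : g m = hg'.toBasis.repr (g m) m • g' m from ⟨_, hg.norm_eq_one_of_eq_smul hg' h, h⟩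
  refine hg'.toBasis.ext_elem fun n => ?_
  rw [map_smul, Finsupp.smul_apply, ← hg'.toBasis_apply, Module.Basis.repr_self,
    Finsupp.single_apply, smul_eq_mul]
  obtain rfl | hne := eq_or_ne m n
  · rw [if_pos rfl, mul_one]
  · rw [if_neg hne, mul_zero, hg.repr_eq_zero hq0 hq1 hα hg' hne.symm]

end IsCoupledBasis

theorem exists_smul_eq_psiVec (hq0 : 0 < q) (hq1 : q < 1) (hα : Admissible α)
    {g : (Fin d → ℕ) → W 𝕜 d} (hg : IsCoupledBasis q α g) :
    ∃ ε : (Fin d → ℕ) → 𝕜, (∀ n, ‖ε n‖ = 1) ∧ (fun n => ε n • g n) = psiVec 𝕜 q α := by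
  choose ε hε hsmul using
    (isCoupledBasis_psiVec hq0 hq1 hα).exists_eq_smul hq0 hq1 hα.neg_one_lt hg
  exact ⟨ε, hε, funext fun n => (hsmul n).symm⟩

end Uniqueness

end SuQ

theorem proposition1_general (𝕜 : Type*) [RCLike 𝕜] (q : ℝ) (hq0 : 0 < q) (hq1 : q < 1)
    (d : ℕ) (α : Fin d → ℝ) (hα : SuQ.Admissible α) :
    (∀ n, {y | SuQ.Psi q α n y ≠ 0}.Finite) ∧
    (∀ y, {n | SuQ.Psi q α n y ≠ 0}.Finite) ∧
    (∀ n n', ∑ᶠ y, SuQ.Psi q α n y * SuQ.Psi q α n' y = if n = n' then 1 else 0) ∧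
    (∀ y y', ∑ᶠ n, SuQ.Psi q α n y * SuQ.Psi q α n y' = if y = y' then 1 else 0) ∧
    (∃ g : (Fin d → ℕ) → SuQ.W 𝕜 d,
      SuQ.IsCoupledBasis q α g ∧ SuQ.HasPsiExpansions q α g) ∧
    (∀ g : (Fin d → ℕ) → SuQ.W 𝕜 d, SuQ.IsCoupledBasis q α g →
      ∃ ε : (Fin d → ℕ) → 𝕜, (∀ n, ‖ε n‖ = 1) ∧
        SuQ.HasPsiExpansions q α fun n => ε n • g n) := by
  refine ⟨SuQ.finite_setOf_Psi_ne_zero, SuQ.finite_setOf_Psi_ne_zero',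
    SuQ.finsum_Psi_mul hq0 hq1 hα, SuQ.finsum_Psi_mul' hq0 hq1 hα,
    ⟨SuQ.psiVec 𝕜 q α, SuQ.isCoupledBasis_psiVec hq0 hq1 hα,
      SuQ.hasPsiExpansions_psiVec hq0 hq1 hα⟩, fun g hg => ?_⟩
  obtain ⟨ε, hε, heq⟩ := SuQ.exists_smul_eq_psiVec hq0 hq1 hα hg
  exact ⟨ε, hε, heq ▸ SuQ.hasPsiExpansions_psiVec hq0 hq1 hα⟩

theorem proposition1 (𝕜 : Type*) [RCLike 𝕜] (q : ℝ) (hq0 : 0 < q) (hq1 : q < 1)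
    (d : ℕ) (hd : 1 ≤ d) (α : Fin d → ℝ) (hα : ∀ i, 0 < α i) :
    -- all the sums below have finitely many nonzero terms
    (∀ n, {y | SuQ.Psi q α n y ≠ 0}.Finite) ∧
    (∀ y, {n | SuQ.Psi q α n y ≠ 0}.Finite) ∧
    -- orthogonality relations
    (∀ n n', ∑ᶠ y, SuQ.Psi q α n y * SuQ.Psi q α n' y = if n = n' then 1 else 0) ∧
    (∀ y y', ∑ᶠ n, SuQ.Psi q α n y * SuQ.Psi q α n y' = if y = y' then 1 else 0) ∧
    -- a coupled basis with the expansion formulas exists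
    (∃ g : (Fin d → ℕ) → SuQ.W 𝕜 d,
      SuQ.IsCoupledBasis q α g ∧ SuQ.HasPsiExpansions q α g) ∧
    -- every coupled basis is that one, up to the free choice of a phase of each vector
    (∀ g : (Fin d → ℕ) → SuQ.W 𝕜 d, SuQ.IsCoupledBasis q α g →
      ∃ ε : (Fin d → ℕ) → 𝕜, (∀ n, ‖ε n‖ = 1) ∧
        SuQ.HasPsiExpansions q α fun n => ε n • g n) :=
  proposition1_general 𝕜 q hq0 hq1 d α (.of_pos hα)
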